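/- Let $k\ge 1$ be an integer and let $G$ be a finite simple undirected graph. A tree decomposition of $G$ is a finite tree $T$ together with a set $X_t\subseteq V(G)$ (a bag) for every node $t$ of $T$ such that every vertex of $G$ lies in some bag, both ends of every edge of $G$ lie in a common bag, and for every vertex $v$ of $G$ the nodes $t$ with $v\in X_t$ induce a connected subtree of $T$. Its width is $\max_t |X_t|-1$, and the treewidth $\operatorname{tw}(G)$ is the smallest width of a tree decomposition of $G$. If $\operatorname{tw}(G)\ge 32k+2$, then $G$ contains as a subgraph a graph that is obtained from the complete graph $K_4$ by subdividing each edge at least $k$ times, i.e. by replacing the six edges of $K_4$ by internally disjoint paths with at least $k$ internal vertices (at least $k+1$ edges) each; the numbers of subdivisions may differ from edge to edge. -/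

import Mathlib

universe u

/-- A tree decomposition of `G`: a finite tree, each of whose nodes carries a bag of vertices. -/
structure TreeDecomposition {V : Type u} (G : SimpleGraph V) where
  /-- The nodes of the tree. -/
  Node : Type
  [fintypeNode : Fintype Node]
  tree : SimpleGraph Node
  isTree : tree.IsTree
  bag : Node → Finset V
  /-- Every vertex lies in some bag. -/
  exists_mem_bag : ∀ v : V, ∃ t, v ∈ bag t
  /-- Both ends of every edge lie in a common bag. -/
  exists_edge_bag : ∀ u v : V, G.Adj u v → ∃ t, u ∈ bag t ∧ v ∈ bag t
  /-- The nodes whose bags contain a given vertex induce a connected subtree. -/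
  connected_nodes : ∀ v : V, (tree.induce {t | v ∈ bag t}).Connected

attribute [instance] TreeDecomposition.fintypeNode

/-- The size of the largest bag, minus one (an integer: it is `-1` for the null graph). -/
def TreeDecomposition.width {V : Type u} {G : SimpleGraph V} (D : TreeDecomposition G) : ℤ :=
  ((Finset.univ.sup fun t => (D.bag t).card : ℕ) : ℤ) - 1

/-- The smallest width of a tree decomposition of the finite graph `G`. The one-bag decomposition
always exists and no width is below `-1`, so this infimum is a minimum. -/
noncomputable def treewidth {V : Type u} [Finite V] (G : SimpleGraph V) : ℤ :=
  ⨅ D : TreeDecomposition G, D.width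

/-- A presentation of the graph `F` as the result of subdividing every edge of the complete graph
`K₄` at least `k` times: four distinct branch vertices and, for each of the six edges `ij` of `K₄`
(indexed by `i < j`), a path joining the branch vertices `i` and `j`. -/
structure TetrahedronSubdivision {W : Type u} (k : ℕ) (F : SimpleGraph W) where
  branch : Fin 4 → W
  branch_injective : Function.Injective branch
  path : ∀ i j : Fin 4, i < j → F.Walk (branch i) (branch j)
  isPath : ∀ (i j : Fin 4) (h : i < j), (path i j h).IsPath
  /-- At least `k` subdivision vertices, that is, at least `k + 1` edges. -/
  le_length : ∀ (i j : Fin 4) (h : i < j), k + 1 ≤ (path i j h).length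
  /-- The paths of two different edges of `K₄` meet only in ends of both of them. -/
  inter_ends : ∀ (i j : Fin 4) (h : i < j) (i' j' : Fin 4) (h' : i' < j'), (i, j) ≠ (i', j') →
    ∀ x, x ∈ (path i j h).support → x ∈ (path i' j' h').support →
      (x = branch i ∨ x = branch j) ∧ (x = branch i' ∨ x = branch j')
  /-- `F` has no vertices besides those of the six paths. -/
  vertex_mem : ∀ x : W, ∃ (i j : Fin 4) (h : i < j), x ∈ (path i j h).support
  /-- `F` has no edges besides those of the six paths. -/
  edge_mem : ∀ e ∈ F.edgeSet, ∃ (i j : Fin 4) (h : i < j), e ∈ (path i j h).edges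

/-- `F` can be obtained by subdividing each edge of `K₄` at least `k` times (the numbers of
subdivisions may differ from edge to edge). -/
def IsSubdividedTetrahedron {W : Type u} (k : ℕ) (F : SimpleGraph W) : Prop :=
  Nonempty (TetrahedronSubdivision k F)

/-! By tree-width duality (Seymour and Thomas), large tree-width yields a bramble, a family of
pairwise touching connected sets, that no `32 * k + 2` vertices cover
(`exists_isBramble_of_le_treewidth`). Vertex sets are then measured by `localOrder`, the number of
vertices needed to cover the members they meet. This measure is monotone, subadditive and at most
the cardinality, so a path can be cut at any prescribed value. A set of small local order is missed
by some member, and the union of two members is connected; this supplies all connections below.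

The bramble gives a claw, three disjoint legs of local order `7 * k + 1` leaving a vertex `x`
(`IsBramble.exists_claw`), and a cycle that misses the claw but meets every member missing the claw
(`IsBramble.exists_cycle_disjoint`). Keep the first `k - 1` vertices of each leg and let `n i` be
the next one. It remains to join the three `n i` to the cycle by disjoint paths that avoid the kept
part and whose ends are far apart on the cycle; `x` and these ends are the branch vertices.

The three paths are found one at a time by the augmenting form of Menger's theorem
(`IsLinkage.exists_augment`). It may reroute the paths but keeps their ends on the cycle, so the
vertices near old ends can be forbidden in advance (`IsSpreadLinkage.exists_augment`). Two vertices
never block the augmentation, because a leg has larger local order than everything forbidden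
together (`IsBramble.notSeparated_of_claw`). The same augmentation gives the linkages needed for
duality. -/

theorem List.IsChain.of_isInfix {α : Type*} {R : α → α → Prop} {l s : List α} (h : l.IsChain R)
    (hs : s <:+: l) : s.IsChain R := by
  obtain ⟨u, v, rfl⟩ := hs
  exact h.left_of_append.right_of_append

/-! ### Paths as lists of vertices. -/

namespace SimpleGraph

variable {V : Type u} {G : SimpleGraph V}

/-- A list of distinct vertices, consecutive ones being adjacent: a path given by its vertices. -/
def IsPathList (G : SimpleGraph V) (l : List V) : Prop :=
  l.IsChain G.Adj ∧ l.Nodup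

namespace IsPathList

theorem of_isInfix {l s : List V} (h : G.IsPathList l) (hs : s <:+: l) : G.IsPathList s :=
  ⟨h.1.of_isInfix hs, h.2.sublist hs.sublist⟩

theorem append_left {s t : List V} (h : G.IsPathList (s ++ t)) : G.IsPathList s :=
  h.of_isInfix (List.prefix_append s t).isInfix

theorem append_right {s t : List V} (h : G.IsPathList (s ++ t)) : G.IsPathList t :=
  h.of_isInfix (List.suffix_append s t).isInfix

theorem singleton (v : V) : G.IsPathList [v] := ⟨by simp, by simp⟩

/-- Two paths that share exactly one end can be joined there. -/
theorem join {s t : List V} {x : V} (hs : G.IsPathList (s ++ [x])) (ht : G.IsPathList (x :: t))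
    (hd : s.Disjoint (x :: t)) : G.IsPathList (s ++ x :: t) :=
  ⟨List.isChain_split.2 ⟨hs.1, ht.1⟩, List.nodup_append'.2 ⟨hs.append_left.2, ht.2, hd⟩⟩

theorem take_through {s t : List V} {x : V} (h : G.IsPathList (s ++ x :: t)) :
    G.IsPathList (s ++ [x]) :=
  h.of_isInfix ⟨[], t, by simp⟩

theorem reverse {l : List V} (h : G.IsPathList l) : G.IsPathList l.reverse :=
  ⟨List.isChain_reverse.2 (h.1.imp fun _ _ h => h.symm), List.nodup_reverse.2 h.2⟩

theorem mono {H : SimpleGraph V} {l : List V} (h : G.IsPathList l)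
    (hH : ∀ u ∈ l, ∀ v ∈ l, G.Adj u v → H.Adj u v) : H.IsPathList l := by
  refine ⟨?_, h.2⟩
  have := h.1
  rw [List.isChain_iff_getElem] at this ⊢
  intro i hi
  exact hH _ (List.getElem_mem _) _ (List.getElem_mem _) (this i hi)

theorem connected_induce {l : List V} (h : G.IsPathList l) (hne : l ≠ []) :
    (G.induce {v | v ∈ l}).Connected := by
  have hs := Walk.support_ofSupport hne h.1
  have := (Walk.ofSupport l hne h.1).connected_induce_support
  rwa [hs] at this

end IsPathList

theorem exists_isPathList_of_preconnected {S : Set V} (hS : (G.induce S).Preconnected) {u v : V}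
    (hu : u ∈ S) (hv : v ∈ S) :
    ∃ l, G.IsPathList l ∧ l.head? = some u ∧ l.getLast? = some v ∧ ∀ z ∈ l, z ∈ S := by
  classical
  obtain ⟨w⟩ := hS ⟨u, hu⟩ ⟨v, hv⟩
  let p := w.bypass.map (Embedding.induce S).toHom
  have hp : p.IsPath := w.bypass_isPath.map Subtype.val_injective
  refine ⟨p.support, ⟨p.isChain_adj_support, hp.support_nodup⟩, ?_, ?_, ?_⟩
  · rw [List.head?_eq_some_head (Walk.support_ne_nil _), Walk.head_support]; rfl
  · rw [List.getLast?_eq_some_getLast (Walk.support_ne_nil _), Walk.getLast_support]; rfl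
  · intro z hz
    simp only [p, Walk.support_map, List.mem_map] at hz
    obtain ⟨y, -, rfl⟩ := hz
    exact y.2

end SimpleGraph

namespace List

variable {α : Type*}

theorem exists_first_split {l : List α} {p : α → Prop} (h : ∃ x ∈ l, p x) :
    ∃ s x t, l = s ++ x :: t ∧ p x ∧ ∀ y ∈ s, ¬ p y := by
  induction l with
  | nil => simp at h
  | cons a l ih =>
    by_cases ha : p a
    · exact ⟨[], a, l, rfl, ha, by simp⟩
    · obtain ⟨s, x, t, rfl, hx, hs⟩ := ih (by simpa [ha] using h)
      exact ⟨a :: s, x, t, rfl, hx, by simpa [ha] using hs⟩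

theorem exists_last_split {l : List α} {p : α → Prop} (h : ∃ x ∈ l, p x) :
    ∃ s x t, l = s ++ x :: t ∧ p x ∧ ∀ y ∈ t, ¬ p y := by
  obtain ⟨s, x, t, hl, hx, hs⟩ := exists_first_split (l := l.reverse) (by simpa using h)
  refine ⟨t.reverse, x, s.reverse, ?_, hx, by simpa using hs⟩
  rw [← l.reverse_reverse, hl]
  simp

theorem eq_cons_of_head? {l : List α} {a : α} (h : l.head? = some a) : ∃ t, l = a :: t :=
  head?_eq_some_iff.1 h

theorem mem_of_head?_eq {l : List α} {a : α} (h : l.head? = some a) : a ∈ l :=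
  mem_of_mem_head? h

theorem mem_of_getLast?_eq {l : List α} {a : α} (h : l.getLast? = some a) : a ∈ l :=
  mem_of_mem_getLast? h

end List

/-! ### Bridges and linkages. -/

namespace SimpleGraph

variable {V : Type u} {G : SimpleGraph V}

/-- A path from `S` to `T` contains a path from `S` to `T` with no inner vertex in `S ∪ T`. -/
theorem IsPathList.exists_bridge {l : List V} (hl : G.IsPathList l) {S T : Set V}
    (hST : Disjoint S T) {a b : V} (ha : l.head? = some a) (hb : l.getLast? = some b)
    (haS : a ∈ S) (hbT : b ∈ T) :
    ∃ x ρ y, G.IsPathList (x :: ρ ++ [y]) ∧ x ∈ S ∧ y ∈ T ∧ (∀ z ∈ ρ, z ∉ S ∧ z ∉ T) ∧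
      ∀ z ∈ x :: ρ ++ [y], z ∈ l := by
  obtain ⟨s, y, t, rfl, hy, hs⟩ := List.exists_first_split (l := l) (p := (· ∈ T))
    ⟨b, List.mem_of_getLast?_eq hb, hbT⟩
  have has : a ∈ s := by
    cases s with
    | nil => simp at ha; subst ha; exact absurd hy (Set.disjoint_left.1 hST haS)
    | cons c s => simp at ha; simp [ha]
  obtain ⟨s₁, x, s₂, rfl, hx, hs₂⟩ := List.exists_last_split (l := s) (p := (· ∈ S)) ⟨a, has, haS⟩
  refine ⟨x, s₂, y, hl.of_isInfix ⟨s₁, t, by simp⟩, hx, hy, fun z hz => ⟨hs₂ z hz, hs z ?_⟩, ?_⟩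
  · simp [hz]
  · intro z hz
    simp at hz ⊢
    tauto

/-- A family of disjoint paths, one for every `e ∈ E`, that start at `e`, end in `A` and have no
vertex but `e` in `B`. -/
structure IsLinkage (G : SimpleGraph V) (A B : Set V) (E : Finset V) (p : V → List V) : Prop where
  isPathList : ∀ e ∈ E, G.IsPathList (p e)
  head : ∀ e ∈ E, (p e).head? = some e
  last : ∀ e ∈ E, ∃ a ∈ A, (p e).getLast? = some a
  mem : ∀ e ∈ E, e ∈ B
  eq_of_mem : ∀ e ∈ E, ∀ z ∈ p e, z ∈ B → z = e
  disjoint : ∀ e ∈ E, ∀ f ∈ E, e ≠ f → (p e).Disjoint (p f)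

theorem IsLinkage.self_mem {A B : Set V} {E : Finset V} {p : V → List V}
    (h : G.IsLinkage A B E p) {e : V} (he : e ∈ E) : e ∈ p e :=
  List.mem_of_head?_eq (h.head e he)

/-- Prolonging two paths of a linkage into `B' ⊇ B` so that it becomes a linkage into `B`. -/
theorem IsLinkage.prolong [DecidableEq V] {A B B' : Set V} (hB : B ⊆ B') {F : Finset V}
    {p : V → List V}
    {x y u v : V} (hxy : x ≠ y) (huv : u ≠ v) (hxF : x ∉ F) (hyF : y ∉ F)
    (h : G.IsLinkage A B' (insert x (insert y F)) p) (hFB : ∀ f ∈ F, f ∈ B)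
    {α β : List V} (hα : G.IsPathList (α ++ [x])) (hβ : G.IsPathList (β ++ [y]))
    (hαB : ∀ z ∈ α, z ∈ B') (hβB : ∀ z ∈ β, z ∈ B')
    (hαF : ∀ z ∈ α, z ∉ insert x (insert y F)) (hβF : ∀ z ∈ β, z ∉ insert x (insert y F))
    (hαβ : α.Disjoint β) (hu : (α ++ [x]).head? = some u) (hv : (β ++ [y]).head? = some v)
    (huB : u ∈ B) (hvB : v ∈ B) (hαu : ∀ z ∈ α ++ [x], z ∈ B → z = u)
    (hβv : ∀ z ∈ β ++ [y], z ∈ B → z = v) (huF : u ∉ F) (hvF : v ∉ F) :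
    ∃ q, G.IsLinkage A B (insert u (insert v F)) q := by
  have hx : x ∈ insert x (insert y F) := by simp
  have hy : y ∈ insert x (insert y F) := by simp
  have hF : ∀ f ∈ F, f ∈ insert x (insert y F) := by simp +contextual
  obtain ⟨px, hpx⟩ := List.eq_cons_of_head? (h.head x hx)
  obtain ⟨py, hpy⟩ := List.eq_cons_of_head? (h.head y hy)
  -- The added pieces lie in `B'`, which the old linkage meets only in its ends, so they cannot run
  -- into it elsewhere.
  have key : ∀ γ : List V, (∀ z ∈ γ, z ∈ B') → (∀ z ∈ γ, z ∉ insert x (insert y F)) →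
      ∀ f ∈ insert x (insert y F), γ.Disjoint (p f) := by
    intro γ h1 h2 f hf z hz hz'
    exact h2 z hz (by rw [h.eq_of_mem f hf z hz' (h1 z hz)]; exact hf)
  have kα := key α hαB hαF
  have kβ := key β hβB hβF
  let q : V → List V := fun z => if z = u then α ++ p x else if z = v then β ++ p y else p z
  have qu : q u = α ++ p x := by simp [q]
  have qv : q v = β ++ p y := by simp [q, huv.symm]
  have qf : ∀ f ∈ F, q f = p f := by
    intro f hf
    have h1 : f ≠ u := fun h => huF (h ▸ hf)
    have h2 : f ≠ v := fun h => hvF (h ▸ hf)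
    simp [q, h1, h2]
  have duv : (α ++ p x).Disjoint (β ++ p y) := by
    rw [List.disjoint_append_left, List.disjoint_append_right, List.disjoint_append_right]
    exact ⟨⟨hαβ, kα y hy⟩, (kβ x hx).symm, h.disjoint x hx y hy hxy⟩
  have duf : ∀ f ∈ F, (α ++ p x).Disjoint (p f) := by
    intro f hf
    rw [List.disjoint_append_left]
    exact ⟨kα f (hF f hf), h.disjoint x hx f (hF f hf) (fun h => hxF (h ▸ hf))⟩
  have dvf : ∀ f ∈ F, (β ++ p y).Disjoint (p f) := by
    intro f hf
    rw [List.disjoint_append_left]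
    exact ⟨kβ f (hF f hf), h.disjoint y hy f (hF f hf) (fun h => hyF (h ▸ hf))⟩
  refine ⟨q, ⟨?_, ?_, ?_, ?_, ?_, ?_⟩⟩
  · intro e he
    rcases Finset.mem_insert.1 he with rfl | he
    · rw [qu, hpx]
      exact hα.join (hpx ▸ h.isPathList x hx) (hpx ▸ kα x hx)
    rcases Finset.mem_insert.1 he with rfl | he
    · rw [qv, hpy]
      exact hβ.join (hpy ▸ h.isPathList y hy) (hpy ▸ kβ y hy)
    · rw [qf e he]; exact h.isPathList e (hF e he)
  · intro e he
    rcases Finset.mem_insert.1 he with rfl | he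
    · rw [qu, hpx, ← hu]; cases α <;> simp
    rcases Finset.mem_insert.1 he with rfl | he
    · rw [qv, hpy, ← hv]; cases β <;> simp
    · rw [qf e he]; exact h.head e (hF e he)
  · intro e he
    rcases Finset.mem_insert.1 he with rfl | he
    · obtain ⟨a, ha, h'⟩ := h.last x hx
      exact ⟨a, ha, by rw [qu, List.getLast?_append, h']; rfl⟩
    rcases Finset.mem_insert.1 he with rfl | he
    · obtain ⟨a, ha, h'⟩ := h.last y hy
      exact ⟨a, ha, by rw [qv, List.getLast?_append, h']; rfl⟩
    · rw [qf e he]; exact h.last e (hF e he)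
  · intro e he
    rcases Finset.mem_insert.1 he with rfl | he
    · exact huB
    rcases Finset.mem_insert.1 he with rfl | he
    · exact hvB
    · exact hFB e he
  · intro e he z hz hzB
    rcases Finset.mem_insert.1 he with rfl | he
    · rw [qu, List.mem_append] at hz
      rcases hz with hz | hz
      · exact hαu z (by simp [hz]) hzB
      · have := h.eq_of_mem x hx z hz (hB hzB)
        exact hαu z (by simp [this]) hzB
    rcases Finset.mem_insert.1 he with rfl | he
    · rw [qv, List.mem_append] at hz
      rcases hz with hz | hz
      · exact hβv z (by simp [hz]) hzB
      · have := h.eq_of_mem y hy z hz (hB hzB)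
        exact hβv z (by simp [this]) hzB
    · rw [qf e he] at hz; exact h.eq_of_mem e (hF e he) z hz (hB hzB)
  · intro e he f hf hef
    rcases Finset.mem_insert.1 he with rfl | he₁
    · rcases Finset.mem_insert.1 hf with rfl | hf
      · exact absurd rfl hef
      rcases Finset.mem_insert.1 hf with rfl | hf
      · rw [qu, qv]; exact duv
      · rw [qu, qf f hf]; exact duf f hf
    rcases Finset.mem_insert.1 he₁ with rfl | he₂
    · rcases Finset.mem_insert.1 hf with rfl | hf
      · rw [qu, qv]; exact duv.symm
      rcases Finset.mem_insert.1 hf with rfl | hf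
      · exact absurd rfl hef
      · rw [qv, qf f hf]; exact dvf f hf
    · rcases Finset.mem_insert.1 hf with rfl | hf
      · rw [qu, qf e he₂]; exact (duf e he₂).symm
      rcases Finset.mem_insert.1 hf with rfl | hf
      · rw [qv, qf e he₂]; exact (dvf e he₂).symm
      · rw [qf e he₂, qf f hf]; exact h.disjoint e (hF e he₂) f (hF f hf) hef

end SimpleGraph

/-! ### Menger's theorem by augmentation. -/

namespace SimpleGraph

variable {V : Type u} {G : SimpleGraph V}

/-- No vertex set with at most `n` elements separates `A` from `B`. -/
def NotSeparated (G : SimpleGraph V) (A B : Set V) (n : ℕ) : Prop :=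
  ∀ Z : Finset V, Z.card ≤ n → ∃ l, G.IsPathList l ∧ (∃ b ∈ B, l.head? = some b) ∧
    (∃ a ∈ A, l.getLast? = some a) ∧ ∀ z ∈ l, z ∉ Z

/-- Augmentation form of Menger's theorem: a linkage that has at most as many paths as vertices fail
to separate can be enlarged, keeping its ends in `B`. -/
theorem IsLinkage.exists_augment {A B : Set V} {E : Finset V} {p : V → List V}
    (h : G.IsLinkage A B E p) (hsep : G.NotSeparated A B E.card) :
    ∃ E' : Finset V, E ⊆ E' ∧ E'.card = E.card + 1 ∧ ∃ q, G.IsLinkage A B E' q := by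
  classical
  -- Induction on the total length of the linkage, with the target `B` free to grow.
  induction hn : ∑ e ∈ E, (p e).length using Nat.strong_induction_on generalizing B E p with
  | _ n ih =>
  obtain ⟨R₀, hR₀, ⟨b, hbB, hb⟩, ⟨a, haA, ha⟩, hRE₀⟩ := hsep E le_rfl
  -- Cut at its last vertex in `B`, the path avoiding `E` meets `B` only in its start `r`; if it
  -- misses the linkage, it can simply be added.
  obtain ⟨s₀, r, t₀, rfl, hrB, ht₀⟩ := List.exists_last_split (l := R₀) (p := (· ∈ B))
    ⟨b, List.mem_of_head?_eq hb, hbB⟩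
  have hR : G.IsPathList (r :: t₀) := hR₀.append_right
  have hRE : ∀ z ∈ r :: t₀, z ∉ E := fun z hz => hRE₀ z (by simp at hz ⊢; tauto)
  have hrE : r ∉ E := hRE r (by simp)
  replace ha : (r :: t₀).getLast? = some a := by simpa using ha
  by_cases hmeet : ∃ z ∈ r :: t₀, ∃ e ∈ E, z ∈ p e
  swap
  · push Not at hmeet
    refine ⟨insert r E, Finset.subset_insert _ _, Finset.card_insert_of_notMem hrE,
      Function.update p r (r :: t₀), ?_⟩
    have hu : ∀ f ∈ E, Function.update p r (r :: t₀) f = p f := fun f hf =>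
      Function.update_of_ne (fun hfr : f = r => hrE (hfr ▸ hf)) _ _
    have hd : ∀ f ∈ E, (r :: t₀).Disjoint (p f) := fun f hf z hz hz' => hmeet z hz f hf hz'
    refine ⟨?_, ?_, ?_, ?_, ?_, ?_⟩
    · intro e he
      rcases Finset.mem_insert.1 he with rfl | he
      · simpa using hR
      · rw [hu e he]; exact h.isPathList e he
    · intro e he
      rcases Finset.mem_insert.1 he with rfl | he
      · simp
      · rw [hu e he]; exact h.head e he
    · intro e he
      rcases Finset.mem_insert.1 he with rfl | he
      · exact ⟨a, haA, by simpa using ha⟩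
      · rw [hu e he]; exact h.last e he
    · intro e he
      rcases Finset.mem_insert.1 he with rfl | he
      · exact hrB
      · exact h.mem e he
    · intro e he z hz hzB
      rcases Finset.mem_insert.1 he with rfl | he
      · rw [Function.update_self] at hz
        rcases List.mem_cons.1 hz with rfl | hz
        · rfl
        · exact absurd hzB (ht₀ z hz)
      · rw [hu e he] at hz; exact h.eq_of_mem e he z hz hzB
    · intro e he f hf hef
      rcases Finset.mem_insert.1 he with rfl | he₁
      · rcases Finset.mem_insert.1 hf with rfl | hf₁
        · exact absurd rfl hef
        · rw [Function.update_self, hu f hf₁]; exact hd f hf₁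
      · rcases Finset.mem_insert.1 hf with rfl | hf₁
        · rw [Function.update_self, hu e he₁]; exact (hd e he₁).symm
        · rw [hu e he₁, hu f hf₁]; exact h.disjoint e he₁ f hf₁ hef
  · obtain ⟨σ, x, τ, hRσ, ⟨e, heE, hxe⟩, hσ⟩ := List.exists_first_split hmeet
    have hσE : ∀ z ∈ σ, z ∉ E := fun z hz => hRE z (by rw [hRσ]; simp [hz])
    have hxE : x ∉ E := hRE x (by rw [hRσ]; simp)
    have hxB : x ∉ B := fun hxB => hxE (h.eq_of_mem e heE x hxe hxB ▸ heE)
    obtain ⟨σ', rfl⟩ : ∃ σ', σ = r :: σ' := by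
      cases σ with
      | nil =>
        simp only [List.nil_append, List.cons.injEq] at hRσ
        exact absurd (hRσ.1 ▸ hrB) hxB
      | cons c σ' => simp at hRσ; exact ⟨σ', by rw [hRσ.1]⟩
    obtain ⟨s, t, hpe⟩ := List.append_of_mem hxe
    have hex : e ≠ x := fun h => hxE (h ▸ heE)
    obtain ⟨s', rfl⟩ : ∃ s', s = e :: s' := by
      have := h.head e heE
      rw [hpe] at this
      cases s with
      | nil => simp at this; exact absurd this.symm hex
      | cons c s' => simp at this; exact ⟨s', by rw [this]⟩
    have hPe : G.IsPathList ((e :: s') ++ x :: t) := hpe ▸ h.isPathList e heE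
    have hPR : G.IsPathList ((r :: σ') ++ x :: τ) := hRσ ▸ hR
    have hsub : ∀ z ∈ (e :: s') ++ [x], z ∈ p e := by
      intro z hz; rw [hpe]; simp at hz ⊢; tauto
    have hsσ : ∀ z ∈ r :: σ', z ∉ e :: s' := fun z hz hz' =>
      hσ z hz ⟨e, heE, hsub z (by simp only [List.mem_append]; exact Or.inl hz')⟩
    have hσB : ∀ z ∈ r :: σ', z ∈ B → z = r := by
      intro z hz hzB
      rcases List.mem_cons.1 hz with rfl | hz
      · rfl
      · refine absurd hzB (ht₀ z ?_)
        simp at hRσ; rw [hRσ]; simp [hz]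
    have hsB : ∀ z ∈ e :: s', z ∈ B → z = e := fun z hz hzB =>
      h.eq_of_mem e heE z (hsub z (by simp only [List.mem_append]; exact Or.inl hz)) hzB
    have hxs : x ∉ e :: s' := fun hx => by
      have := List.nodup_append'.1 hPe.2
      exact this.2.2 hx (by simp)
    have hxσ : x ∉ r :: σ' := fun hx => by
      have := List.nodup_append'.1 hPR.2
      exact this.2.2 hx (by simp)
    -- With `x` the first vertex of the new path on the linkage, lying on `p e`, both initial
    -- segments up to `x` are absorbed into the target. Replacing `p e` by its part from `x` on
    -- gives an equally large linkage into `B'` that is strictly shorter in total, and `B'` is no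
    -- easier to separate than `B`.
    let B' : Set V := B ∪ {z | z ∈ e :: s'} ∪ {z | z ∈ r :: σ'} ∪ {x}
    have hBB' : B ⊆ B' := fun z hz => Or.inl (Or.inl (Or.inl hz))
    have hsB' : ∀ z ∈ e :: s', z ∈ B' := fun z hz => Or.inl (Or.inl (Or.inr hz))
    have hσB' : ∀ z ∈ r :: σ', z ∈ B' := fun z hz => Or.inl (Or.inr hz)
    have hxE' : x ∉ E.erase e := fun hx => hxE (Finset.mem_of_mem_erase hx)
    have hup : ∀ f ∈ E.erase e, Function.update p x (x :: t) f = p f := fun f hf =>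
      Function.update_of_ne (fun hfx : f = x => hxE' (hfx ▸ hf)) _ _
    have hd : ∀ f ∈ E.erase e, (p f).Disjoint (p e) := fun f hf =>
      h.disjoint f (Finset.mem_of_mem_erase hf) e heE (Finset.ne_of_mem_erase hf)
    have htsub : ∀ z ∈ x :: t, z ∈ p e := by
      intro z hz; rw [hpe, List.mem_append]; exact Or.inr hz
    have hlink : G.IsLinkage A B' (insert x (E.erase e)) (Function.update p x (x :: t)) := by
      refine ⟨?_, ?_, ?_, ?_, ?_, ?_⟩
      · intro f hf
        rcases Finset.mem_insert.1 hf with rfl | hf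
        · simpa using hPe.append_right
        · rw [hup f hf]; exact h.isPathList f (Finset.mem_of_mem_erase hf)
      · intro f hf
        rcases Finset.mem_insert.1 hf with rfl | hf
        · simp
        · rw [hup f hf]; exact h.head f (Finset.mem_of_mem_erase hf)
      · intro f hf
        rcases Finset.mem_insert.1 hf with rfl | hf
        · obtain ⟨a', ha', h'⟩ := h.last e heE
          rw [hpe, List.getLast?_append] at h'
          exact ⟨a', ha', by simpa using h'⟩
        · rw [hup f hf]; exact h.last f (Finset.mem_of_mem_erase hf)
      · intro f hf
        rcases Finset.mem_insert.1 hf with rfl | hf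
        · exact Or.inr rfl
        · exact hBB' (h.mem f (Finset.mem_of_mem_erase hf))
      · intro f hf z hz hzB
        rcases Finset.mem_insert.1 hf with rfl | hf
        · rw [Function.update_self] at hz
          have hzs : z ∉ e :: s' := fun hzs => (List.nodup_append'.1 hPe.2).2.2 hzs hz
          rcases hzB with ((hzB | hzB) | hzB) | hzB
          · have := h.eq_of_mem e heE z (htsub z hz) hzB
            subst this
            simp at hzs
          · exact absurd hzB hzs
          · exact absurd ⟨e, heE, htsub z hz⟩ (hσ z hzB)
          · exact hzB
        · rw [hup f hf] at hz
          rcases hzB with ((hzB | hzB) | hzB) | hzB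
          · exact h.eq_of_mem f (Finset.mem_of_mem_erase hf) z hz hzB
          · exact (hd f hf hz (hsub z (List.mem_append_left _ hzB))).elim
          · exact absurd ⟨f, Finset.mem_of_mem_erase hf, hz⟩ (hσ z hzB)
          · rw [Set.mem_singleton_iff] at hzB
            exact (hd f hf hz (hzB ▸ hxe)).elim
      · intro f hf g hg hfg
        rcases Finset.mem_insert.1 hf with rfl | hf₁
        · rcases Finset.mem_insert.1 hg with rfl | hg₁
          · exact absurd rfl hfg
          · rw [Function.update_self, hup g hg₁]
            exact fun z hz hz' => hd g hg₁ hz' (htsub z hz)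
        · rcases Finset.mem_insert.1 hg with rfl | hg₁
          · rw [Function.update_self, hup f hf₁]
            exact fun z hz hz' => hd f hf₁ hz (htsub z hz')
          · rw [hup f hf₁, hup g hg₁]
            exact h.disjoint f (Finset.mem_of_mem_erase hf₁) g (Finset.mem_of_mem_erase hg₁) hfg
    have hcard : (insert x (E.erase e)).card = E.card := by
      rw [Finset.card_insert_of_notMem hxE', Finset.card_erase_add_one heE]
    have hsum : ∑ f ∈ insert x (E.erase e), (Function.update p x (x :: t) f).length < n := by
      rw [Finset.sum_insert hxE', Function.update_self, ← hn, ← Finset.add_sum_erase E _ heE, hpe]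
      rw [Finset.sum_congr rfl (fun f hf => by rw [hup f hf])]
      simp only [List.length_append, List.length_cons]
      omega
    obtain ⟨E', hEE', hE'card, p₂, hp₂⟩ := ih _ hsum hlink (by
      rw [hcard]
      intro Z hZ
      obtain ⟨l, hl, ⟨b', hb', h1⟩, h2⟩ := hsep Z hZ
      exact ⟨l, hl, ⟨b', hBB' hb', h1⟩, h2⟩) rfl
    obtain ⟨y, hy⟩ : (E' \ insert x (E.erase e)).Nonempty := by
      rw [← Finset.card_pos, Finset.card_sdiff_of_subset hEE']; omega
    rw [Finset.mem_sdiff] at hy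
    have hyx : x ≠ y := fun h => hy.2 (by simp [h])
    have hyE : y ∉ E.erase e := fun h => hy.2 (by simp [h])
    have hE' : E' = insert x (insert y (E.erase e)) := by
      symm
      refine Finset.eq_of_subset_of_card_le ?_ ?_
      · intro z hz
        simp only [Finset.mem_insert] at hz
        rcases hz with rfl | rfl | hz
        · exact hEE' (by simp)
        · exact hy.1
        · exact hEE' (by simp [hz])
      · rw [Finset.card_insert_of_notMem, Finset.card_insert_of_notMem hyE, hE'card, hcard,
          Finset.card_erase_add_one heE]
        simp only [Finset.mem_insert, not_or]
        exact ⟨hyx, hxE'⟩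
    subst hE'
    have hyB' : y ∈ B' := hp₂.mem y hy.1
    have hEB : ∀ f ∈ E.erase e, f ∈ B := fun f hf => h.mem f (Finset.mem_of_mem_erase hf)
    have hsE : ∀ z ∈ e :: s', z ∉ E.erase e := fun z hz hzE =>
      hd z hzE (h.self_mem (Finset.mem_of_mem_erase hzE)) (hsub z (List.mem_append_left _ hz))
    have heE' : e ∉ E.erase e := Finset.notMem_erase e E
    have hrE' : r ∉ E.erase e := fun hr => hrE (Finset.mem_of_mem_erase hr)
    have her : e ≠ r := fun h => hrE (h ▸ heE)
    have hins : ∀ w, insert e (insert w (E.erase e)) = insert w E := fun w => by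
      rw [Finset.insert_comm, Finset.insert_erase heE]
    have hins' : ∀ w, insert w (insert e (E.erase e)) = insert w E := fun w => by
      rw [Finset.insert_erase heE]
    have hσE' : ∀ z ∈ r :: σ', z ∉ E.erase e := fun z hz hz' =>
      hσE z hz (Finset.mem_of_mem_erase hz')
    have hconcl : ∀ w, w ∉ E → (∃ q, G.IsLinkage A B (insert w E) q) →
        ∃ E' : Finset V, E ⊆ E' ∧ E'.card = E.card + 1 ∧ ∃ q, G.IsLinkage A B E' q :=
      fun w hw hq => ⟨insert w E, Finset.subset_insert _ _, Finset.card_insert_of_notMem hw, hq⟩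
    -- The induction adds one end `y`. If `y` lies on the absorbed piece of `p e`, it is led back to
    -- `e` and `x` to `r`; if it lies on the piece of the new path, it is led back to `r` and `x` to
    -- `e`; otherwise `y` is already in `B` and only `x` is led back to `e`.
    by_cases hys : y ∈ e :: s'
    · refine hconcl r hrE ?_
      rw [← hins']
      obtain ⟨s₁, s₂, hs₁⟩ := List.append_of_mem hys
      have hs₁sub : ∀ z ∈ s₁ ++ [y], z ∈ e :: s' := by
        intro z hz; rw [hs₁]; simp at hz ⊢; tauto
      have hpl : G.IsPathList (s₁ ++ [y]) := hPe.of_isInfix ⟨[], s₂ ++ x :: t, by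
        rw [hs₁]; simp⟩
      have hys₁ : y ∉ s₁ := fun hy' =>
        (List.nodup_append'.1 hpl.2).2.2 hy' (by simp)
      refine hp₂.prolong hBB' hyx her.symm hxE' hyE hEB (α := r :: σ') (β := s₁)
        hPR.take_through hpl hσB'
        (fun z hz => hsB' z (hs₁sub z (List.mem_append_left _ hz))) ?_ ?_ ?_ (by simp) ?_ hrB
        (h.mem e heE) ?_ ?_ hrE' heE'
      · intro z hz
        simp only [Finset.mem_insert, not_or]
        exact ⟨fun h => hxσ (h ▸ hz), fun h => hsσ z hz (h ▸ hys), hσE' z hz⟩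
      · intro z hz
        have hz' := hs₁sub z (List.mem_append_left _ hz)
        simp only [Finset.mem_insert, not_or]
        exact ⟨fun h => hxs (h ▸ hz'), fun h => hys₁ (h ▸ hz), hsE z hz'⟩
      · exact fun z hz hz' => hsσ z hz (hs₁sub z (List.mem_append_left _ hz'))
      · have : (s₁ ++ y :: s₂).head? = some e := by rw [← hs₁]; rfl
        cases s₁ <;> simpa using this
      · intro z hz hzB
        rcases List.mem_append.1 hz with hz | hz
        · exact hσB z hz hzB
        · rw [List.mem_singleton] at hz; exact absurd (hz ▸ hzB) hxB
      · exact fun z hz hzB => hsB z (hs₁sub z hz) hzB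
    · have hαF : ∀ z ∈ e :: s', z ∉ insert x (insert y (E.erase e)) := by
        intro z hz
        simp only [Finset.mem_insert, not_or]
        exact ⟨fun h => hxs (h ▸ hz), fun h => hys (h ▸ hz), hsE z hz⟩
      have hαB : ∀ z ∈ e :: s' ++ [x], z ∈ B → z = e := fun z hz hzB =>
        h.eq_of_mem e heE z (hsub z hz) hzB
      by_cases hyσ : y ∈ r :: σ'
      · refine hconcl r hrE ?_
        rw [← hins]
        obtain ⟨s₁, s₂, hs₁⟩ := List.append_of_mem hyσ
        have hs₁sub : ∀ z ∈ s₁ ++ [y], z ∈ r :: σ' := by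
          intro z hz; rw [hs₁]; simp at hz ⊢; tauto
        have hpl : G.IsPathList (s₁ ++ [y]) := hPR.of_isInfix ⟨[], s₂ ++ x :: τ, by
          rw [hs₁]; simp⟩
        have hys₁ : y ∉ s₁ := fun hy' =>
          (List.nodup_append'.1 hpl.2).2.2 hy' (by simp)
        refine hp₂.prolong hBB' hyx her hxE' hyE hEB (α := e :: s') (β := s₁)
          hPe.take_through hpl hsB'
          (fun z hz => hσB' z (hs₁sub z (List.mem_append_left _ hz))) hαF ?_ ?_ (by simp) ?_
          (h.mem e heE) hrB hαB ?_ heE' hrE'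
        · intro z hz
          have hz' := hs₁sub z (List.mem_append_left _ hz)
          simp only [Finset.mem_insert, not_or]
          exact ⟨fun h => hxσ (h ▸ hz'), fun h => hys₁ (h ▸ hz), hσE' z hz'⟩
        · exact fun z hz hz' => hsσ z (hs₁sub z (List.mem_append_left _ hz')) hz
        · have : (s₁ ++ y :: s₂).head? = some r := by rw [← hs₁]; rfl
          cases s₁ <;> simpa using this
        · exact fun z hz hzB => hσB z (hs₁sub z hz) hzB
      · have hyB : y ∈ B := by
          rcases hyB' with ((hyB | hyB) | hyB) | hyB
          · exact hyB
          · exact absurd hyB hys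
          · exact absurd hyB hyσ
          · exact absurd hyB.symm hyx
        have hye : e ≠ y := fun h => hys (by simp [h])
        refine hconcl y (fun hy' => hyE (Finset.mem_erase.2 ⟨hye.symm, hy'⟩)) ?_
        rw [← hins]
        refine hp₂.prolong hBB' hyx hye hxE' hyE hEB (α := e :: s') (β := []) hPe.take_through
          (IsPathList.singleton y) hsB' (by simp) hαF (by simp) (by simp) (by simp) (by simp)
          (h.mem e heE) hyB hαB (by simp) heE' hyE

/-- Menger's theorem: if fewer than `n` vertices never separate `A` from `B`, then some `n` vertices
of `B` are the ends of `n` disjoint paths from `A`. -/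
theorem exists_linkage_of_notSeparated {A B : Set V} (n : ℕ)
    (hsep : ∀ m < n, G.NotSeparated A B m) :
    ∃ E : Finset V, E.card = n ∧ ∃ p, G.IsLinkage A B E p := by
  induction n with
  | zero => exact ⟨∅, rfl, fun _ => [], by constructor <;> simp⟩
  | succ n ih =>
    obtain ⟨E, hE, p, hp⟩ := ih fun m hm => hsep m (by omega)
    obtain ⟨E', -, hE', hq⟩ := hp.exists_augment (hE ▸ hsep n (by omega))
    exact ⟨E', by omega, hq⟩

end SimpleGraph

/-! ### Tree decompositions of induced subgraphs: gluing and contraction. -/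

namespace SimpleGraph

variable {V : Type u} {G : SimpleGraph V}

theorem Connected.induce_image {W W' : Type*} {T : SimpleGraph W} {T' : SimpleGraph W'}
    (f : T →g T') {N : Set W} (h : (T.induce N).Connected) :
    (T'.induce (Set.image f N)).Connected := by
  let g : T.induce N →g T'.induce (Set.image f N) :=
    ⟨fun x => ⟨f x, Set.mem_image_of_mem f x.2⟩, fun {a b} hab => f.map_adj hab⟩
  refine h.map g ?_
  rintro ⟨_, x, hx, rfl⟩
  exact ⟨⟨x, hx⟩, rfl⟩

/-- A tree decomposition of the subgraph of `G` induced by `S`. -/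
structure PartialDecomposition (G : SimpleGraph V) (S : Set V) where
  Node : Type
  [fintypeNode : Fintype Node]
  tree : SimpleGraph Node
  isTree : tree.IsTree
  bag : Node → Finset V
  bag_subset : ∀ t, ∀ v ∈ bag t, v ∈ S
  exists_mem_bag : ∀ v ∈ S, ∃ t, v ∈ bag t
  exists_edge_bag : ∀ u ∈ S, ∀ v ∈ S, G.Adj u v → ∃ t, u ∈ bag t ∧ v ∈ bag t
  connected_nodes : ∀ v ∈ S, (tree.induce {t | v ∈ bag t}).Connected

attribute [instance] PartialDecomposition.fintypeNode

namespace PartialDecomposition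

/-- The decomposition with a single bag. -/
def single (G : SimpleGraph V) (X : Finset V) : PartialDecomposition G (X : Set V) where
  Node := Unit
  tree := ⊥
  isTree := ⟨⟨fun _ _ => Reachable.refl _⟩, IsAcyclic.of_card_le_two (by simp)⟩
  bag _ := X
  bag_subset _ _ h := h
  exists_mem_bag _ h := ⟨(), h⟩
  exists_edge_bag _ hu _ hv _ := ⟨(), hu, hv⟩
  connected_nodes v hv := by
    have : Nonempty {t : Unit | v ∈ X} := ⟨⟨(), hv⟩⟩
    exact ⟨fun a b => by rw [Subsingleton.elim a b]⟩

/-- Gluing two decompositions along their common part. -/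
theorem exists_glue {S₁ S₂ : Set V} (D₁ : PartialDecomposition G S₁)
    (D₂ : PartialDecomposition G S₂) (s₁ : D₁.Node) (s₂ : D₂.Node)
    (h₁ : ∀ v ∈ S₁, v ∈ S₂ → v ∈ D₁.bag s₁) (h₂ : ∀ v ∈ S₁, v ∈ S₂ → v ∈ D₂.bag s₂)
    (hadj : ∀ u ∈ S₁, ∀ v ∈ S₂, G.Adj u v → u ∈ S₂ ∨ v ∈ S₁) :
    ∃ D : PartialDecomposition G (S₁ ∪ S₂), (∃ s, D.bag s = D₁.bag s₁) ∧
      ∀ t, (∃ t₁, D.bag t = D₁.bag t₁) ∨ ∃ t₂, D.bag t = D₂.bag t₂ := by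
  let T := (D₁.tree ⊕g D₂.tree) ⊔ edge (Sum.inl s₁) (Sum.inr s₂)
  let f₁ : D₁.tree →g T := ⟨Sum.inl, fun h => Or.inl (by simpa using h)⟩
  let f₂ : D₂.tree →g T := ⟨Sum.inr, fun h => Or.inl (by simpa using h)⟩
  have hT : T.IsTree := by
    refine isTree_iff_connected_and_card.2 ⟨D₁.isTree.1.sum_sup_edge D₂.isTree.1, ?_⟩
    have e₁ := (isTree_iff_connected_and_card.1 D₁.isTree).2
    have e₂ := (isTree_iff_connected_and_card.1 D₂.isTree).2
    have e₃ := Nat.card_congr (edgeSetSumEquiv (G := D₁.tree) (H := D₂.tree))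
    have e₄ : T.edgeSet = insert s(Sum.inl s₁, Sum.inr s₂) (D₁.tree ⊕g D₂.tree).edgeSet := by
      simp only [T]
      rw [edgeSet_sup, edgeSet_edge_of_ne (by simp), Set.union_comm, Set.singleton_union]
    rw [e₄, Nat.card_coe_set_eq, Set.ncard_insert_of_notMem (by simp) (Set.toFinite _),
      ← Nat.card_coe_set_eq, e₃, Nat.card_sum, Nat.card_sum]
    omega
  have hedge : T.Adj (Sum.inl s₁) (Sum.inr s₂) := Or.inr (by simp [edge_adj])
  let bag : D₁.Node ⊕ D₂.Node → Finset V := Sum.elim D₁.bag D₂.bag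
  have hset : ∀ v, {t | v ∈ bag t} = Set.image f₁ {t | v ∈ D₁.bag t} ∪
      Set.image f₂ {t | v ∈ D₂.bag t} := by
    intro v
    ext t
    cases t <;> simp [bag, f₁, f₂]
  refine ⟨⟨D₁.Node ⊕ D₂.Node, T, hT, bag, ?_, ?_, ?_, ?_⟩, ⟨Sum.inl s₁, rfl⟩, ?_⟩
  · rintro (t | t) v hv
    · exact Or.inl (D₁.bag_subset t v hv)
    · exact Or.inr (D₂.bag_subset t v hv)
  · rintro v (hv | hv)
    · obtain ⟨t, ht⟩ := D₁.exists_mem_bag v hv; exact ⟨Sum.inl t, ht⟩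
    · obtain ⟨t, ht⟩ := D₂.exists_mem_bag v hv; exact ⟨Sum.inr t, ht⟩
  · have k₁ : ∀ u ∈ S₁, ∀ v ∈ S₁, G.Adj u v → ∃ t, u ∈ bag t ∧ v ∈ bag t := by
      intro u hu v hv h
      obtain ⟨t, ht⟩ := D₁.exists_edge_bag u hu v hv h; exact ⟨Sum.inl t, ht⟩
    have k₂ : ∀ u ∈ S₂, ∀ v ∈ S₂, G.Adj u v → ∃ t, u ∈ bag t ∧ v ∈ bag t := by
      intro u hu v hv h
      obtain ⟨t, ht⟩ := D₂.exists_edge_bag u hu v hv h; exact ⟨Sum.inr t, ht⟩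
    rintro u (hu | hu) v (hv | hv) h
    · exact k₁ u hu v hv h
    · rcases hadj u hu v hv h with h' | h'
      · exact k₂ u h' v hv h
      · exact k₁ u hu v h' h
    · rcases hadj v hv u hu h.symm with h' | h'
      · exact k₂ u hu v h' h
      · exact k₁ u h' v hv h
    · exact k₂ u hu v hv h
  · intro v hv
    rw [hset]
    by_cases hv₁ : v ∈ S₁
    · have c₁ := (D₁.connected_nodes v hv₁).induce_image f₁
      by_cases hv₂ : v ∈ S₂
      · have c₂ := (D₂.connected_nodes v hv₂).induce_image f₂
        exact connected_induce_union c₁.preconnected c₂.preconnected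
          ⟨s₁, h₁ v hv₁ hv₂, rfl⟩ ⟨s₂, h₂ v hv₁ hv₂, rfl⟩ hedge
      · have : {t | v ∈ D₂.bag t} = ∅ := by
          ext t; simpa using fun h => hv₂ (D₂.bag_subset t v h)
        rw [this, Set.image_empty, Set.union_empty]
        exact c₁
    · have c₂ := (D₂.connected_nodes v (hv.resolve_left hv₁)).induce_image f₂
      have : {t | v ∈ D₁.bag t} = ∅ := by
        ext t; simpa using fun h => hv₁ (D₁.bag_subset t v h)
      rw [this, Set.image_empty, Set.empty_union]
      exact c₂
  · rintro (t | t)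
    · exact Or.inl ⟨t, rfl⟩
    · exact Or.inr ⟨t, rfl⟩

/-- If a connected set meets the bags of two nodes, it meets the bag of every node between them. -/
theorem exists_mem_bag_of_mem_support {S : Set V} (D : PartialDecomposition G S) {B : Set V}
    (hBS : B ⊆ S) (hB : (G.induce B).Preconnected) {s s' t : D.Node} {b b' : V} (hb : b ∈ B)
    (hbs : b ∈ D.bag s) (hb' : b' ∈ B) (hbs' : b' ∈ D.bag s') {p : D.tree.Walk s s'}
    (hp : p.IsPath) (ht : t ∈ p.support) : ∃ v ∈ B, v ∈ D.bag t := by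
  classical
  let N : Set D.Node := {t | ∃ v ∈ B, v ∈ D.bag t}
  have step : ∀ v (hv : v ∈ B) t₁ t₂ (h₁ : v ∈ D.bag t₁) (h₂ : v ∈ D.bag t₂),
      (D.tree.induce N).Reachable ⟨t₁, v, hv, h₁⟩ ⟨t₂, v, hv, h₂⟩ := by
    intro v hv t₁ t₂ h₁ h₂
    have := (D.connected_nodes v (hBS hv)).preconnected ⟨t₁, h₁⟩ ⟨t₂, h₂⟩
    exact this.map (induceHomOfLE D.tree (s := {t | v ∈ D.bag t}) (s' := N)
      (fun t ht => ⟨v, hv, ht⟩)).toHom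
  have main : ∀ (x y : B) (_ : (G.induce B).Walk x y) t₁ t₂ (h₁ : x.1 ∈ D.bag t₁)
      (h₂ : y.1 ∈ D.bag t₂),
      (D.tree.induce N).Reachable ⟨t₁, x.1, x.2, h₁⟩ ⟨t₂, y.1, y.2, h₂⟩ := by
    intro x y w
    induction w with
    | @nil x => exact fun t₁ t₂ h₁ h₂ => step _ x.2 t₁ t₂ h₁ h₂
    | @cons x z y hxz w ih =>
      intro t₁ t₂ h₁ h₂
      obtain ⟨t₃, hx, hz⟩ := D.exists_edge_bag x.1 (hBS x.2) z.1 (hBS z.2) hxz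
      exact (step _ x.2 t₁ t₃ h₁ hx).trans (ih t₃ t₂ hz h₂)
  obtain ⟨w⟩ := hB ⟨b, hb⟩ ⟨b', hb'⟩
  obtain ⟨q⟩ := main _ _ w s s' hbs hbs'
  let q' := q.bypass.map (Embedding.induce N).toHom
  have hq' : q'.IsPath := q.bypass_isPath.map Subtype.val_injective
  -- The nodes whose bags meet `B` are connected in the tree, and tree paths are unique, so `p` is
  -- the path found among these nodes.
  have heq : p = q' := congrArg Subtype.val
    ((D.isTree.2.subsingleton_path s s').elim ⟨p, hp⟩ ⟨q', hq'⟩)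
  have hsup : t ∈ q'.support := heq ▸ ht
  obtain ⟨y, -, rfl⟩ := List.mem_map.1 (Walk.support_map _ q.bypass ▸ hsup)
  exact y.2

/-- Contracting a linkage: a decomposition of `G` with a bag linked onto `X` yields one of
`X ∪ C`, where `C` is disjoint from the linkage, in which `X` is that bag. -/
theorem exists_contract (D : PartialDecomposition G Set.univ) {X : Finset V} {C : Set V}
    (hXC : ∀ x ∈ X, x ∉ C) (s : D.Node) {p : V → List V}
    (hp : G.IsLinkage (D.bag s : Set V) (X : Set V) X p) (hpC : ∀ x ∈ X, ∀ z ∈ p x, z ∉ C) :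
    ∃ D' : PartialDecomposition G ((X : Set V) ∪ C), (∃ s', X ⊆ D'.bag s') ∧
      ∀ t', ∃ t, (D'.bag t').card ≤ (D.bag t).card ∧ (∀ v ∈ C, v ∈ D'.bag t' → v ∈ D.bag t) ∧
        ∀ B : Set V, (G.induce B).Preconnected → (∃ v ∈ B, v ∈ D.bag s) →
          (∀ v ∈ B, v ∉ D.bag t) → ∀ v ∈ B, v ∉ D'.bag t' := by
  classical
  choose τ hτ using fun v : V => D.exists_mem_bag v trivial
  choose π hπ using fun v : V => (D.isTree.1.preconnected s (τ v)).exists_isPath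
  -- Restrict every bag to `X ∪ C`, and put each `x ∈ X` into all bags on the tree path from `s` to
  -- a node whose bag already contains `x`.
  let bag : D.Node → Finset V := fun t =>
    (D.bag t).filter (· ∈ (X : Set V) ∪ C) ∪ X.filter fun x => t ∈ (π x).support
  have hmem : ∀ t v, v ∈ bag t ↔
      (v ∈ D.bag t ∧ (v ∈ X ∨ v ∈ C)) ∨ (v ∈ X ∧ t ∈ (π v).support) := by
    intro t v; simp [bag]
  refine ⟨⟨D.Node, D.tree, D.isTree, bag, ?_, ?_, ?_, ?_⟩, ⟨s, ?_⟩, fun t => ⟨t, ?_, ?_, ?_⟩⟩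
  · intro t v hv
    rcases (hmem t v).1 hv with ⟨-, h⟩ | ⟨h, -⟩
    · exact h
    · exact Or.inl h
  · intro v hv
    exact ⟨τ v, (hmem _ _).2 (Or.inl ⟨hτ v, hv⟩)⟩
  · intro u hu v hv huv
    obtain ⟨t, h₁, h₂⟩ := D.exists_edge_bag u trivial v trivial huv
    exact ⟨t, (hmem _ _).2 (Or.inl ⟨h₁, hu⟩), (hmem _ _).2 (Or.inl ⟨h₂, hv⟩)⟩
  · intro v hv
    have hc := D.connected_nodes v trivial
    by_cases hvX : v ∈ X
    · have : {t | v ∈ bag t} = {t | v ∈ D.bag t} ∪ {t | t ∈ (π v).support} := by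
        ext t; simp [hmem, hvX]
      rw [this]
      exact induce_union_connected hc.preconnected (π v).connected_induce_support.preconnected
        ⟨τ v, hτ v, (π v).end_mem_support⟩
    · have : {t | v ∈ bag t} = {t | v ∈ D.bag t} := by
        have hvC : v ∈ C := hv.resolve_left hvX
        ext t; simp [hmem, hvX, hvC]
      rw [this]
      exact hc
  · intro x hx
    exact (hmem _ _).2 (Or.inr ⟨hx, (π x).start_mem_support⟩)
  · have hex : ∀ v, v ∈ bag t → v ∉ D.bag t → v ∈ X ∧ ∃ w ∈ p v, w ∈ D.bag t := by
      intro v hv hvt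
      rcases (hmem t v).1 hv with h | ⟨hvX, ht⟩
      · exact absurd h.1 hvt
      refine ⟨hvX, ?_⟩
      obtain ⟨a, ha, hlast⟩ := hp.last v hvX
      have hne : p v ≠ [] := List.ne_nil_of_mem (hp.self_mem hvX)
      obtain ⟨w, hw, hwt⟩ := D.exists_mem_bag_of_mem_support (B := {z | z ∈ p v})
        (Set.subset_univ _) ((hp.isPathList v hvX).connected_induce hne).preconnected
        (List.mem_of_getLast?_eq hlast) ha (hp.self_mem hvX) (hτ v) (hπ v) ht
      exact ⟨w, hw, hwt⟩
    -- Bags do not grow: a vertex `v` newly put into the bag of `t` is charged to a vertex of `p v`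
    -- in the old bag, which exists because `p v` is connected and has vertices in bags on both
    -- sides of `t`. Disjointness of the paths, and their missing `C`, make this injective.
    let g : V → V := fun v => if h : ∃ w ∈ p v, w ∈ D.bag t ∧ v ∉ D.bag t then h.choose else v
    have hg₁ : ∀ v, v ∈ D.bag t → g v = v := by
      intro v hv
      simp only [g]
      rw [dif_neg]
      rintro ⟨w, -, -, h⟩
      exact h hv
    have hg₂ : ∀ v, v ∈ bag t → v ∉ D.bag t → g v ∈ p v ∧ g v ∈ D.bag t := by
      intro v hv hvt
      obtain ⟨-, w, hw, hwt⟩ := hex v hv hvt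
      have h : ∃ w ∈ p v, w ∈ D.bag t ∧ v ∉ D.bag t := ⟨w, hw, hwt, hvt⟩
      simp only [g]
      rw [dif_pos h]
      exact ⟨h.choose_spec.1, h.choose_spec.2.1⟩
    have hg₃ : ∀ v, v ∈ bag t → v ∉ D.bag t → ∀ w, w ∈ bag t → w ∈ D.bag t → g v ≠ w := by
      intro v hv hvt w hw hwt hvw
      have hvX := (hex v hv hvt).1
      have hgv := hg₂ v hv hvt
      rw [hvw] at hgv
      have hwXC : w ∈ X ∨ w ∈ C := by
        rcases (hmem t w).1 hw with h | h
        · exact h.2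
        · exact Or.inl h.1
      rcases hwXC with h | h
      · have := hp.eq_of_mem v hvX w hgv.1 h
        exact hvt (this ▸ hwt)
      · exact hpC v hvX w hgv.1 h
    refine Finset.card_le_card_of_injOn g ?_ ?_
    · intro v hv
      by_cases hvt : v ∈ D.bag t
      · rw [hg₁ v hvt]; exact hvt
      · exact (hg₂ v hv hvt).2
    · intro v hv w hw hvw
      by_cases hvt : v ∈ D.bag t
      · by_cases hwt : w ∈ D.bag t
        · rwa [hg₁ v hvt, hg₁ w hwt] at hvw
        · rw [hg₁ v hvt] at hvw
          exact absurd hvw.symm (hg₃ w hw hwt v hv hvt)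
      · by_cases hwt : w ∈ D.bag t
        · rw [hg₁ w hwt] at hvw
          exact absurd hvw (hg₃ v hv hvt w hw hwt)
        · by_contra hne
          refine hp.disjoint v (hex v hv hvt).1 w (hex w hw hwt).1 hne (hg₂ v hv hvt).1 ?_
          rw [hvw]
          exact (hg₂ w hw hwt).1
  · intro v hvC hv
    rcases (hmem t v).1 hv with h | h
    · exact h.1
    · exact absurd hvC (hXC v h.1)
  · rintro B hB ⟨b, hbB, hbs⟩ hBt v hvB hv
    rcases (hmem t v).1 hv with h | ⟨hvX, ht⟩
    · exact hBt v hvB h.1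
    · obtain ⟨w, hw, hwt⟩ := D.exists_mem_bag_of_mem_support (Set.subset_univ _) hB hbB hbs hvB
        (hτ v) (hπ v) ht
      exact hBt w hw hwt

end PartialDecomposition

end SimpleGraph

/-! ### Brambles and tree-width duality. -/

namespace SimpleGraph

variable {V : Type u} {G : SimpleGraph V}

/-- A family of connected sets any two of which touch. -/
def IsBramble (G : SimpleGraph V) (𝓑 : Set (Set V)) : Prop :=
  ∀ B ∈ 𝓑, ∀ B' ∈ 𝓑, (G.induce (B ∪ B')).Connected

theorem IsBramble.connected {𝓑 : Set (Set V)} (h : G.IsBramble 𝓑) {B : Set V} (hB : B ∈ 𝓑) :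
    (G.induce B).Connected := by
  have := h B hB B hB
  rwa [Set.union_self] at this

theorem IsBramble.subset {𝓑 𝓑' : Set (Set V)} (h : G.IsBramble 𝓑) (hs : 𝓑' ⊆ 𝓑) :
    G.IsBramble 𝓑' :=
  fun B hB B' hB' => h B (hs hB) B' (hs hB')

/-- `X` meets every member of `𝓑`. -/
def IsCover (𝓑 : Set (Set V)) (X : Finset V) : Prop :=
  ∀ B ∈ 𝓑, ∃ v ∈ B, v ∈ X

theorem mem_of_isChain_of_closed {C : Set V} {X : Finset V}
    (hC : ∀ u ∈ C, ∀ v, G.Adj u v → v ∈ X ∨ v ∈ C) {z : V} {t : List V}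
    (hchain : (z :: t).IsChain G.Adj) (hz : z ∈ C) (ht : ∀ w ∈ t, w ∉ X) : ∀ w ∈ t, w ∈ C := by
  induction t generalizing z with
  | nil => simp
  | cons y t ih =>
    rw [List.isChain_cons_cons] at hchain
    have hy : y ∈ C := (hC z hz y hchain.1).resolve_left (ht y (by simp))
    intro w hw
    rcases List.mem_cons.1 hw with rfl | hw
    · exact hy
    · exact ih hchain.2 hy (fun w hw => ht w (by simp [hw])) w hw

namespace PartialDecomposition

/-- Every bag with more than `m` elements misses a member of `𝓑`. -/
def Admissible {S : Set V} (D : PartialDecomposition G S) (m : ℕ) (𝓑 : Set (Set V)) : Prop :=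
  ∀ t, m < (D.bag t).card → ∃ B ∈ 𝓑, ∀ v ∈ B, v ∉ D.bag t

/-- If `C` does not touch some member of the bramble, a decomposition with two bags will do. -/
theorem exists_of_not_touching [Finite V] {m : ℕ} {𝓑 : Set (Set V)} (h𝓑 : G.IsBramble 𝓑)
    {X : Finset V} (hXm : X.card ≤ m) {C : Set V} (hCc : (G.induce C).Connected)
    {B : Set V}
    (hB : B ∈ 𝓑) (hBC : ¬ (G.induce (B ∪ C)).Connected) :
    ∃ D : PartialDecomposition G (X ∪ C), (∃ s, X ⊆ D.bag s) ∧ D.Admissible m 𝓑 := by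
  classical
  have := Fintype.ofFinite V
  -- The two bags are `X`, which is small, and `C` with its neighbours in `X`; a vertex of `B` in
  -- the latter would make `B` touch `C`.
  let Y : Finset V := Finset.univ.filter fun v => v ∈ C ∨ (v ∈ X ∧ ∃ c ∈ C, G.Adj c v)
  have hY : ∀ v, v ∈ Y ↔ v ∈ C ∨ (v ∈ X ∧ ∃ c ∈ C, G.Adj c v) := by simp [Y]
  obtain ⟨D, ⟨s, hs⟩, hD⟩ := exists_glue (single G X) (single G Y) () () (fun v hv _ => hv)
    (fun v _ hv => hv) (fun u hu v hv huv => by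
      rcases (hY v).1 hv with h | h
      · exact Or.inl ((hY u).2 (Or.inr ⟨hu, v, h, huv.symm⟩))
      · exact Or.inr h.1)
  have hset : (X : Set V) ∪ (Y : Set V) = (X : Set V) ∪ C := by
    ext v
    simp only [Set.mem_union, Finset.mem_coe, hY]
    tauto
  rw [← hset]
  refine ⟨D, ⟨s, hs ▸ subset_rfl⟩, fun t ht => ⟨B, hB, fun v hv hvt => ?_⟩⟩
  rcases hD t with ⟨_, h⟩ | ⟨_, h⟩
  · rw [h] at ht
    exact absurd ht (by simpa [single] using hXm)
  · rw [h] at hvt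
    rcases (hY v).1 hvt with h | ⟨-, c, hc, hcv⟩
    · exact hBC (induce_union_connected (h𝓑.connected hB).preconnected hCc.preconnected ⟨v, hv, h⟩)
    · exact hBC (connected_induce_union (h𝓑.connected hB).preconnected hCc.preconnected hv hc
        hcv.symm)

/-- The large bag at `s` covers `𝓑`, so the member it misses is `C`. A set with fewer than `X.card`
vertices misses some member of `𝓑`, which joins `X` to that bag; Menger's theorem therefore links
all of `X` to the bag. The paths avoid `C`, since leaving `C` means passing through `X` again.
Contract along them: a new bag missing `C` lies inside `X` and is small, while a large one meets
`C`, so the old bag it comes from misses a member other than `C`, and the new bag misses that member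
too. -/
theorem exists_of_insert {m : ℕ} {𝓑 : Set (Set V)} (h𝓑 : G.IsBramble 𝓑)
    {X : Finset V} (hXm : X.card ≤ m)
    (hmin : ∀ Z, IsCover 𝓑 Z → X.card ≤ Z.card) (hX : IsCover 𝓑 X) {C : Set V}
    (hXC : ∀ x ∈ X, x ∉ C) (hC : ∀ u ∈ C, ∀ v, G.Adj u v → v ∈ X ∨ v ∈ C)
    (D : PartialDecomposition G Set.univ) (hD : D.Admissible m (insert C 𝓑)) {s : D.Node}
    (hsm : m < (D.bag s).card) (hs : IsCover 𝓑 (D.bag s)) :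
    ∃ D : PartialDecomposition G (X ∪ C), (∃ s, X ⊆ D.bag s) ∧ D.Admissible m 𝓑 := by
  have hsC : ∀ v ∈ C, v ∉ D.bag s := by
    obtain ⟨B, hB, hBs⟩ := hD s hsm
    rcases hB with rfl | hB
    · exact hBs
    · obtain ⟨v, hv, hv'⟩ := hs B hB
      exact absurd hv' (hBs v hv)
  obtain ⟨E, hE, p, hp⟩ := exists_linkage_of_notSeparated (G := G) (A := (D.bag s : Set V))
    (B := (X : Set V)) X.card (by
      intro n hn Z hZ
      have : ¬ IsCover 𝓑 Z := fun h => by have := hmin Z h; omega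
      simp only [IsCover] at this
      push Not at this
      obtain ⟨B, hB, hBZ⟩ := this
      obtain ⟨b, hbB, hbX⟩ := hX B hB
      obtain ⟨a, haB, has⟩ := hs B hB
      obtain ⟨l, hl, hb, ha, hlB⟩ :=
        exists_isPathList_of_preconnected (h𝓑.connected hB).preconnected hbB haB
      exact ⟨l, hl, ⟨b, hbX, hb⟩, ⟨a, has, ha⟩, fun z hz => hBZ z (hlB z hz)⟩)
  obtain rfl : E = X := Finset.eq_of_subset_of_card_le (fun e he => hp.mem e he) hE.ge
  have hpC : ∀ x ∈ E, ∀ z ∈ p x, z ∉ C := by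
    intro x hx z hz hzC
    obtain ⟨l₁, l₂, hl⟩ := List.append_of_mem hz
    have hpl := hp.isPathList x hx
    have hhead := hp.head x hx
    obtain ⟨a, ha, hlast⟩ := hp.last x hx
    have heq := hp.eq_of_mem x hx
    rw [hl] at hpl hhead hlast heq
    have hl₂ : ∀ w ∈ l₂, w ∉ E := by
      intro w hw hwE
      have hwx := heq w (by simp [hw]) hwE
      subst hwx
      have hnd := hpl.2
      cases l₁ with
      | nil => simp at hhead; subst hhead; exact hXC _ hx hzC
      | cons y l₁ => simp at hhead; subst hhead; simp [hw] at hnd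
    have hin := mem_of_isChain_of_closed hC hpl.append_right.1 hzC hl₂
    have haC : a ∈ C := by
      have : a ∈ z :: l₂ := by
        apply List.mem_of_getLast?_eq
        simpa using hlast
      rcases List.mem_cons.1 this with rfl | h
      · exact hzC
      · exact hin a h
    exact hsC a haC ha
  obtain ⟨D', hD's, hD'⟩ := D.exists_contract hXC s hp hpC
  refine ⟨D', hD's, fun t' ht' => ?_⟩
  obtain ⟨t, hcard, htC, htB⟩ := hD' t'
  have hmeet : ∃ v ∈ C, v ∈ D'.bag t' := by
    by_contra! h
    have : D'.bag t' ⊆ E := fun v hv =>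
      (D'.bag_subset t' v hv).resolve_right fun hvC => h v hvC hv
    have := Finset.card_le_card this
    omega
  obtain ⟨v, hvC, hv⟩ := hmeet
  obtain ⟨B, hB, hBt⟩ := hD t (by omega)
  rcases hB with rfl | hB
  · exact absurd (htC v hvC hv) (hBt v hvC)
  · exact ⟨B, hB, htB B (h𝓑.connected hB).preconnected (hs B hB) hBt⟩

/-- The tree-decomposition half of tree-width duality, relative to a bramble. -/
theorem exists_admissible [Finite V] {m : ℕ}
    (hcov : ∀ 𝓑, G.IsBramble 𝓑 → ∃ X, IsCover 𝓑 X ∧ X.card ≤ m) (𝓑 : Set (Set V))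
    (h𝓑 : G.IsBramble 𝓑) : ∃ D : PartialDecomposition G Set.univ, D.Admissible m 𝓑 := by
  classical
  -- There are finitely many families of vertex sets, so the claim may be assumed for all strictly
  -- larger brambles.
  induction 𝓑 using WellFoundedGT.induction with
  | _ 𝓑 ih =>
  by_contra! hno
  obtain ⟨X₀, hX₀, hX₀m⟩ := hcov 𝓑 h𝓑
  obtain ⟨X, hX, hmin⟩ := Set.exists_min_image {X : Finset V | IsCover 𝓑 X} Finset.card
    (Set.toFinite _) ⟨X₀, hX₀⟩
  have hXm : X.card ≤ m := (hmin X₀ hX₀).trans hX₀m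
  -- With `X` a minimum cover, it suffices to decompose `X` together with each component `C` of the
  -- rest, keeping `X` inside one bag; the pieces are glued along `X`.
  have part : ∀ C : Set V, (G.induce C).Connected → (∀ x ∈ X, x ∉ C) →
      (∀ u ∈ C, ∀ v, G.Adj u v → v ∈ X ∨ v ∈ C) →
      ∃ D : PartialDecomposition G (X ∪ C), (∃ s, X ⊆ D.bag s) ∧ D.Admissible m 𝓑 := by
    intro C hCc hXC hC
    by_cases htouch : ∃ B ∈ 𝓑, ¬ (G.induce (B ∪ C)).Connected
    · obtain ⟨B, hB, hBC⟩ := htouch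
      exact exists_of_not_touching h𝓑 hXm hCc hB hBC
    · push Not at htouch
      have hCn : C ∉ 𝓑 := fun h => by
        obtain ⟨v, hv, hvX⟩ := hX C h
        exact hXC v hvX hv
      obtain ⟨D, hD⟩ := ih (insert C 𝓑) (Set.ssubset_insert hCn) (by
        rintro B (rfl | hB) B' (rfl | hB')
        · rw [Set.union_self]; exact hCc
        · rw [Set.union_comm]; exact htouch B' hB'
        · exact htouch B hB
        · exact h𝓑 B hB B' hB')
      -- Admissible for the larger bramble but not for `𝓑`, the decomposition has a large bag that
      -- covers `𝓑`.
      have := hno D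
      simp only [Admissible] at this
      push Not at this
      obtain ⟨s, hsm, hs⟩ := this
      exact exists_of_insert h𝓑 hXm hmin hX hXC hC D hD hsm hs
  let comp : (G.induce ((X : Set V)ᶜ)).ConnectedComponent → Set V :=
    fun c => Set.image Subtype.val c.supp
  have hcompX : ∀ c, ∀ x ∈ X, x ∉ comp c := by
    rintro c x hx ⟨y, -, rfl⟩
    exact y.2 hx
  have hcompC : ∀ c, ∀ u ∈ comp c, ∀ v, G.Adj u v → v ∈ X ∨ v ∈ comp c := by
    rintro c _ ⟨y, hy, rfl⟩ v hv
    by_cases hvX : v ∈ X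
    · exact Or.inl hvX
    · refine Or.inr ⟨⟨v, hvX⟩, ?_, rfl⟩
      have hadj : (G.induce ((X : Set V)ᶜ)).Adj y ⟨v, hvX⟩ := hv
      exact c.mem_supp_of_adj_mem_supp hy hadj
  have hcompc : ∀ c, (G.induce (comp c)).Connected := fun c =>
    Connected.induce_image (Embedding.induce ((X : Set V)ᶜ)).toHom
      c.connected_toSimpleGraph
  have hfin : ∀ 𝒞 : Finset (G.induce ((X : Set V)ᶜ)).ConnectedComponent,
      ∃ D : PartialDecomposition G (X ∪ ⋃ c ∈ 𝒞, comp c),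
        (∃ s, X ⊆ D.bag s) ∧ D.Admissible m 𝓑 := by
    intro 𝒞
    induction 𝒞 using Finset.induction_on with
    | empty =>
      have : (X : Set V) ∪ ⋃ c ∈ (∅ : Finset (G.induce ((X : Set V)ᶜ)).ConnectedComponent), comp c
          = X := by simp
      rw [this]
      exact ⟨single G X, ⟨(), subset_rfl⟩, fun t ht => absurd ht (by simpa [single] using hXm)⟩
    | insert c 𝒞 _ ih =>
      obtain ⟨D₁, ⟨s₁, hs₁⟩, h₁⟩ := ih
      obtain ⟨D₂, ⟨s₂, hs₂⟩, h₂⟩ := part (comp c) (hcompc c) (hcompX c) (hcompC c)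
      by_cases hc : c ∈ 𝒞
      · rw [Finset.insert_eq_of_mem hc]
        exact ⟨D₁, ⟨s₁, hs₁⟩, h₁⟩
      have hdisj : ∀ v ∈ comp c, ∀ d ∈ 𝒞, v ∉ comp d := by
        rintro _ ⟨y, hy, rfl⟩ d hd ⟨z, hz, hzy⟩
        obtain rfl : z = y := Subtype.ext hzy
        rw [ConnectedComponent.mem_supp_iff] at hy hz
        exact hc (hy ▸ hz ▸ hd)
      have hX₁₂ : ∀ v ∈ (X : Set V) ∪ ⋃ c ∈ 𝒞, comp c, v ∈ (X : Set V) ∪ comp c → v ∈ X := by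
        rintro v (hv | hv) (hv' | hv')
        · exact hv
        · exact hv
        · exact hv'
        · simp only [Set.mem_iUnion] at hv
          obtain ⟨d, hd, hvd⟩ := hv
          exact absurd hvd (hdisj v hv' d hd)
      obtain ⟨D, ⟨s, hs⟩, hD⟩ := exists_glue D₁ D₂ s₁ s₂ (fun v hv hv' => hs₁ (hX₁₂ v hv hv'))
        (fun v hv hv' => hs₂ (hX₁₂ v hv hv')) (by
          rintro u hu v (hv | hv) huv
          · exact Or.inr (Or.inl hv)
          · exact Or.inl (hcompC c v hv u huv.symm))
      have hset : ((X : Set V) ∪ ⋃ c ∈ 𝒞, comp c) ∪ ((X : Set V) ∪ comp c) =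
          (X : Set V) ∪ ⋃ d ∈ insert c 𝒞, comp d := by
        rw [Finset.set_biUnion_insert]
        ext v
        simp only [Set.mem_union]
        tauto
      rw [← hset]
      refine ⟨D, ⟨s, hs ▸ hs₁⟩, fun t ht => ?_⟩
      rcases hD t with ⟨t', h⟩ | ⟨t', h⟩
      · rw [h] at ht ⊢; exact h₁ t' ht
      · rw [h] at ht ⊢; exact h₂ t' ht
  have := Fintype.ofFinite (G.induce ((X : Set V)ᶜ)).ConnectedComponent
  have hset : (X : Set V) ∪ ⋃ c ∈ (Finset.univ :
      Finset (G.induce ((X : Set V)ᶜ)).ConnectedComponent), comp c = Set.univ := by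
    rw [Set.eq_univ_iff_forall]
    intro v
    by_cases hv : v ∈ X
    · exact Or.inl hv
    · refine Or.inr ?_
      simp only [Set.mem_iUnion]
      exact ⟨(G.induce ((X : Set V)ᶜ)).connectedComponentMk ⟨v, hv⟩, Finset.mem_univ _,
        ⟨v, hv⟩, rfl, rfl⟩
  have hall := hfin Finset.univ
  rw [hset] at hall
  obtain ⟨D, -, hD⟩ := hall
  exact hno D hD

end PartialDecomposition

/-- Large tree-width forces a bramble that has no small cover. -/
theorem exists_isBramble_of_le_treewidth [Finite V] {m : ℕ} (h : (m : ℤ) ≤ treewidth G) :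
    ∃ 𝓑, G.IsBramble 𝓑 ∧ ∀ X, IsCover 𝓑 X → m < X.card := by
  by_contra! hno
  -- For the empty bramble there is no member to miss, so admissibility says that no bag has more
  -- than `m` elements, giving width at most `m - 1`.
  obtain ⟨D, hD⟩ := PartialDecomposition.exists_admissible (G := G) (m := m) hno ∅
    (fun B hB => absurd hB (by simp))
  let D' : TreeDecomposition G :=
    { Node := D.Node
      tree := D.tree
      isTree := D.isTree
      bag := D.bag
      exists_mem_bag := fun v => D.exists_mem_bag v trivial
      exists_edge_bag := fun u v huv => D.exists_edge_bag u trivial v trivial huv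
      connected_nodes := fun v => D.connected_nodes v trivial }
  have hle : treewidth G ≤ D'.width := by
    refine ciInf_le ⟨-1, ?_⟩ D'
    rintro _ ⟨D, rfl⟩
    simp only [TreeDecomposition.width]
    omega
  have hw : (Finset.univ.sup fun t => (D'.bag t).card) ≤ m := by
    refine Finset.sup_le fun t _ => ?_
    by_contra! ht
    obtain ⟨B, hB, -⟩ := hD t ht
    exact hB
  simp only [TreeDecomposition.width] at hle
  omega

end SimpleGraph

/-! ### Local order; paths and cycles that cover a bramble. -/

namespace SimpleGraph

variable {V : Type u} {G : SimpleGraph V} {𝓑 : Set (Set V)}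

/-- The least number of vertices that meet every member of `𝓑` meeting `S`. -/
noncomputable def localOrder (𝓑 : Set (Set V)) (S : Set V) : ℕ :=
  sInf {n | ∃ Z : Finset V, Z.card = n ∧ IsCover {B ∈ 𝓑 | ∃ v ∈ B, v ∈ S} Z}

theorem localOrder_le {S : Set V} {Z : Finset V} (h : IsCover {B ∈ 𝓑 | ∃ v ∈ B, v ∈ S} Z) :
    localOrder 𝓑 S ≤ Z.card :=
  Nat.sInf_le ⟨Z, rfl, h⟩

theorem localOrder_le_card (Z : Finset V) : localOrder 𝓑 (Z : Set V) ≤ Z.card :=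
  localOrder_le fun _ hB => hB.2

theorem localOrder_le_length (l : List V) : localOrder 𝓑 {v | v ∈ l} ≤ l.length := by
  classical
  have h := localOrder_le_card (𝓑 := 𝓑) l.toFinset
  have hs : ((l.toFinset : Finset V) : Set V) = {v | v ∈ l} := by ext; simp
  rw [hs] at h
  exact h.trans l.toFinset_card_le

section Finite

variable [Finite V]

theorem exists_card_eq_localOrder (𝓑 : Set (Set V)) (S : Set V) :
    ∃ Z : Finset V, Z.card = localOrder 𝓑 S ∧ IsCover {B ∈ 𝓑 | ∃ v ∈ B, v ∈ S} Z :=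
  Nat.sInf_mem (s := {n | ∃ Z : Finset V, Z.card = n ∧ IsCover {B ∈ 𝓑 | ∃ v ∈ B, v ∈ S} Z})
    ⟨_, S.toFinite.toFinset, rfl, fun _ hB => by simpa using hB.2⟩

theorem localOrder_mono {S T : Set V} (h : S ⊆ T) : localOrder 𝓑 S ≤ localOrder 𝓑 T := by
  obtain ⟨Z, hZ, hc⟩ := exists_card_eq_localOrder 𝓑 T
  rw [← hZ]
  exact localOrder_le fun B hB => hc B ⟨hB.1, hB.2.imp fun v hv => ⟨hv.1, h hv.2⟩⟩

theorem localOrder_union_le (S T : Set V) :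
    localOrder 𝓑 (S ∪ T) ≤ localOrder 𝓑 S + localOrder 𝓑 T := by
  classical
  obtain ⟨Z, hZ, hc⟩ := exists_card_eq_localOrder 𝓑 S
  obtain ⟨Z', hZ', hc'⟩ := exists_card_eq_localOrder 𝓑 T
  rw [← hZ, ← hZ']
  refine (localOrder_le ?_).trans (Finset.card_union_le Z Z')
  rintro B ⟨hB, v, hv, hvS | hvT⟩
  · obtain ⟨w, hw, hwZ⟩ := hc B ⟨hB, v, hv, hvS⟩
    exact ⟨w, hw, by simp [hwZ]⟩
  · obtain ⟨w, hw, hwZ⟩ := hc' B ⟨hB, v, hv, hvT⟩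
    exact ⟨w, hw, by simp [hwZ]⟩

/-- A set of larger local order has a member of the bramble of its own. -/
theorem exists_meets_of_localOrder_lt {S Y : Set V} (h : localOrder 𝓑 Y < localOrder 𝓑 S) :
    ∃ B ∈ 𝓑, (∃ v ∈ B, v ∈ S) ∧ ∀ v ∈ B, v ∉ Y := by
  by_contra! hno
  obtain ⟨Z, hZ, hc⟩ := exists_card_eq_localOrder 𝓑 Y
  have := localOrder_le (𝓑 := 𝓑) (S := S) (Z := Z) fun B hB => hc B ⟨hB.1, hno B hB.1 hB.2⟩
  omega

theorem lt_localOrder_of_cover {m : ℕ} (hm : ∀ X, IsCover 𝓑 X → m < X.card) {S : Set V}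
    (hS : ∀ B ∈ 𝓑, ∃ v ∈ B, v ∈ S) : m < localOrder 𝓑 S := by
  obtain ⟨Z, hZ, hc⟩ := exists_card_eq_localOrder 𝓑 S
  rw [← hZ]
  exact hm Z fun B hB => hc B ⟨hB, hS B hB⟩

theorem exists_avoids_of_localOrder_le {m : ℕ} (hm : ∀ X, IsCover 𝓑 X → m < X.card) {Y : Set V}
    (hY : localOrder 𝓑 Y ≤ m) : ∃ B ∈ 𝓑, ∀ v ∈ B, v ∉ Y := by
  by_contra! hno
  have := lt_localOrder_of_cover hm hno
  omega

end Finite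

/-- A list whose vertices lie in members of `𝓑` and meet all of these. -/
structure IsCoveringList (𝓑 : Set (Set V)) (l : List V) : Prop where
  mem : ∀ v ∈ l, ∃ B ∈ 𝓑, v ∈ B
  meets : ∀ B ∈ 𝓑, ∃ v ∈ B, v ∈ l

/-- In a shortest covering path, every end is the only vertex of some member of the bramble. -/
theorem exists_shortest_coveringList {l₀ : List V} (hl₀ : G.IsPathList l₀)
    (hc₀ : IsCoveringList 𝓑 l₀) :
    ∃ l, G.IsPathList l ∧ IsCoveringList 𝓑 l ∧
      (∀ s v, l = s ++ [v] → ∃ B ∈ 𝓑, v ∈ B ∧ ∀ w ∈ s, w ∉ B) ∧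
      ∀ s v, l = v :: s → ∃ B ∈ 𝓑, v ∈ B ∧ ∀ w ∈ s, w ∉ B := by
  classical
  have hex : ∃ n l, G.IsPathList l ∧ IsCoveringList 𝓑 l ∧ l.length = n := ⟨_, l₀, hl₀, hc₀, rfl⟩
  obtain ⟨l, hl, hc, hn⟩ := Nat.find_spec hex
  have hmin : ∀ l', G.IsPathList l' → IsCoveringList 𝓑 l' → l.length ≤ l'.length := by
    intro l' h h'
    rw [hn]
    exact Nat.find_min' hex ⟨l', h, h', rfl⟩
  have key : ∀ s v, G.IsPathList s → s.length < l.length → (∀ w, w ∈ l ↔ w = v ∨ w ∈ s) →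
      ∃ B ∈ 𝓑, v ∈ B ∧ ∀ w ∈ s, w ∉ B := by
    intro s v hs hlen hmem
    by_contra! hno
    have := hmin s hs ⟨fun w hw => hc.mem w ((hmem w).2 (Or.inr hw)), fun B hB => by
      obtain ⟨w, hwB, hw⟩ := hc.meets B hB
      rcases (hmem w).1 hw with rfl | hw
      · obtain ⟨w', h, h'⟩ := hno B hB hwB
        exact ⟨w', h', h⟩
      · exact ⟨w, hwB, hw⟩⟩
    omega
  refine ⟨l, hl, hc, ?_, ?_⟩
  · rintro s v rfl
    exact key s v hl.append_left (by simp) fun w => by simp [or_comm]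
  · rintro s v rfl
    exact key s v (hl.of_isInfix ⟨[v], [], by simp⟩) (by simp) fun w => by simp

/-- Members are added one by one. A shortest covering path that misses the new member `B` ends in a
vertex `v` that is its only vertex in some `B'`; it can be continued from `v` to `B` inside `B' ∪ B`
without meeting itself. -/
theorem IsBramble.exists_coveringPath [Finite V] (h : G.IsBramble 𝓑) :
    ∃ l, G.IsPathList l ∧ IsCoveringList 𝓑 l := by
  induction 𝓑, Set.toFinite 𝓑 using Set.Finite.induction_on with
  | empty => exact ⟨[], ⟨by simp, by simp⟩, by simp, by simp⟩
  | @insert B 𝓕 _ _ ih =>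
    obtain ⟨l₀, hl₀, hc₀⟩ := ih (h.subset (Set.subset_insert _ _))
    obtain ⟨l, hl, hc, hlast, -⟩ := exists_shortest_coveringList hl₀ hc₀
    have hmono : ∀ v, (∃ B' ∈ 𝓕, v ∈ B') → ∃ B' ∈ insert B 𝓕, v ∈ B' :=
      fun v ⟨B', hB', hv⟩ => ⟨B', Or.inr hB', hv⟩
    by_cases hB : ∃ v ∈ B, v ∈ l
    · refine ⟨l, hl, fun v hv => hmono v (hc.mem v hv), ?_⟩
      rintro B' (rfl | hB')
      · exact hB
      · exact hc.meets B' hB'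
    push Not at hB
    obtain ⟨⟨b, hb⟩⟩ := (h.connected (Set.mem_insert B 𝓕)).nonempty
    rcases List.eq_nil_or_concat l with rfl | ⟨s, v, rfl⟩
    · refine ⟨[b], .singleton b, ?_, ?_⟩
      · simp only [List.mem_singleton]
        rintro _ rfl
        exact ⟨B, Or.inl rfl, hb⟩
      · rintro B' (rfl | hB')
        · exact ⟨b, hb, by simp⟩
        · simpa using hc.meets B' hB'
    · rw [List.concat_eq_append] at *
      obtain ⟨B', hB', hvB', hsB'⟩ := hlast s v rfl
      obtain ⟨l', hl', hhead, hlast', hl'B⟩ := exists_isPathList_of_preconnected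
        (h B' (Or.inr hB') B (Or.inl rfl)).preconnected (Or.inl hvB') (Or.inr hb)
      obtain ⟨t, rfl⟩ := List.eq_cons_of_head? hhead
      have hd : s.Disjoint (v :: t) := by
        intro z hz hz'
        rcases hl'B z hz' with h | h
        · exact hsB' z hz h
        · exact hB z h (by simp [hz])
      refine ⟨s ++ v :: t, hl.join hl' hd, ?_, ?_⟩
      · intro z hz
        rcases List.mem_append.1 hz with hz | hz
        · exact hmono z (hc.mem z (by simp [hz]))
        · rcases hl'B z hz with h | h
          · exact ⟨B', Or.inr hB', h⟩
          · exact ⟨B, Or.inl rfl, h⟩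
      · rintro B'' (rfl | hB'')
        · exact ⟨b, hb, List.mem_append_right _ (List.mem_of_getLast?_eq hlast')⟩
        · obtain ⟨z, hz, hzl⟩ := hc.meets B'' hB''
          refine ⟨z, hz, ?_⟩
          simp at hzl ⊢
          tauto

/-- A list of distinct vertices, cyclically consecutive ones being adjacent. -/
def IsCycleList (G : SimpleGraph V) (c : List V) : Prop :=
  c.Nodup ∧ (c : Cycle V).Chain G.Adj

/-- Each end of a shortest covering path is its only vertex in some member. A path between the ends
inside the union of these two members avoids the inner vertices, hence closes the cycle. The bound
on covers ensures two distinct ends. -/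
theorem IsBramble.exists_coveringCycle [Finite V] (h : G.IsBramble 𝓑)
    (hm : ∀ X, IsCover 𝓑 X → 1 < X.card) : ∃ c, G.IsCycleList c ∧ IsCoveringList 𝓑 c := by
  obtain ⟨l₀, hl₀, hc₀⟩ := h.exists_coveringPath
  obtain ⟨l, hl, hc, hlast, hhead⟩ := exists_shortest_coveringList hl₀ hc₀
  cases l with
  | nil =>
    have := hm ∅ fun B hB => by simpa using hc.meets B hB
    simp at this
  | cons u l =>
  rcases List.eq_nil_or_concat l with rfl | ⟨m, v, rfl⟩
  · have := hm {u} fun B hB => by simpa using hc.meets B hB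
    simp at this
  rw [List.concat_eq_append] at *
  obtain ⟨B₁, hB₁, huB₁, h₁⟩ := hhead _ _ rfl
  obtain ⟨B₂, hB₂, hvB₂, h₂⟩ := hlast (u :: m) v (by simp)
  obtain ⟨l', hl', hv, hu, hl'B⟩ := exists_isPathList_of_preconnected
    (h B₁ hB₁ B₂ hB₂).preconnected (Or.inr hvB₂) (Or.inl huB₁)
  have huv : u ≠ v := by
    rintro rfl
    have := hl.2
    simp at this
  obtain ⟨t, rfl⟩ := List.eq_cons_of_head? hv
  rcases List.eq_nil_or_concat t with rfl | ⟨ρ, w, rfl⟩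
  · simp at hu
    exact absurd hu.symm huv
  rw [List.concat_eq_append] at *
  have hwu : w = u := by
    rw [← List.cons_append, List.getLast?_concat] at hu
    exact Option.some_inj.1 hu
  subst hwu
  -- Both `m` and `ρ` may be empty, so a single edge can count as a cycle here; the three distinct
  -- ends placed on the cycle later exclude this.
  refine ⟨w :: m ++ v :: ρ, ⟨?_, ?_⟩, ?_, ?_⟩
  · have hnd := hl.2
    have hnd' := hl'.2
    have hρ : ∀ z ∈ ρ, z ∉ m := by
      intro z hz hzm
      rcases hl'B z (by simp [hz]) with h | h
      · exact h₁ z (by simp [hzm]) h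
      · exact h₂ z (by simp [hzm]) h
    simp only [List.cons_append, List.nodup_cons, List.nodup_append', List.mem_append,
      List.mem_cons, List.disjoint_left] at hnd hnd' ⊢
    simp only [List.not_mem_nil, or_false] at hnd hnd'
    refine ⟨?_, hnd.2.1, ⟨?_, hnd'.2.1⟩, ?_⟩
    · rintro (h | rfl | h)
      · exact hnd.1 (Or.inl h)
      · exact huv rfl
      · exact hnd'.2.2.2 h rfl
    · exact fun h => hnd'.1 (Or.inl h)
    · rintro z hz (rfl | h)
      · exact hnd.2.2.2 hz rfl
      · exact hρ z h hz
  · rw [List.cons_append, Cycle.chain_coe_cons]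
    have h₃ : List.IsChain G.Adj ((w :: m) ++ [v]) := hl.1
    simpa using List.isChain_split.2 ⟨h₃, hl'.1⟩
  · intro z hz
    rcases List.mem_append.1 hz with hz | hz
    · exact hc.mem z (by simp at hz ⊢; tauto)
    · rcases hl'B z (by simp at hz ⊢; tauto) with h | h
      · exact ⟨B₁, hB₁, h⟩
      · exact ⟨B₂, hB₂, h⟩
  · intro B hB
    obtain ⟨z, hz, hzl⟩ := hc.meets B hB
    refine ⟨z, hz, ?_⟩
    simp at hzl ⊢
    tauto

/-- A set of small local order is missed by a cycle that covers all members of the bramble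
missing it. -/
theorem IsBramble.exists_cycle_disjoint [Finite V] (h : G.IsBramble 𝓑) {m : ℕ}
    (hm : ∀ X, IsCover 𝓑 X → m < X.card) {S : Set V} (hS : localOrder 𝓑 S + 1 ≤ m) :
    ∃ c, G.IsCycleList c ∧ (∀ v ∈ c, v ∉ S) ∧
      ∀ B ∈ 𝓑, (∀ v ∈ B, v ∉ S) → ∃ v ∈ B, v ∈ c := by
  classical
  -- In the bramble of the members missing `S`, a cover together with a smallest cover of the
  -- members meeting `S` covers `𝓑`, so it has more than one element.
  obtain ⟨c, hc, hc'⟩ := IsBramble.exists_coveringCycle (𝓑 := {B ∈ 𝓑 | ∀ v ∈ B, v ∉ S})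
    (h.subset fun B hB => hB.1) (by
      intro X hX
      obtain ⟨Z, hZ, hcov⟩ := exists_card_eq_localOrder 𝓑 S
      have := hm (X ∪ Z) (by
        intro B hB
        by_cases hBS : ∃ v ∈ B, v ∈ S
        · obtain ⟨v, hv, hvZ⟩ := hcov B ⟨hB, hBS⟩
          exact ⟨v, hv, by simp [hvZ]⟩
        · push Not at hBS
          obtain ⟨v, hv, hvX⟩ := hX B ⟨hB, hBS⟩
          exact ⟨v, hv, by simp [hvX]⟩)
      have := Finset.card_union_le X Z
      omega)
  refine ⟨c, hc, fun v hv => ?_, fun B hB hBS => hc'.meets B ⟨hB, hBS⟩⟩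
  obtain ⟨B, hB, hvB⟩ := hc'.mem v hv
  exact hB.2 v hvB

end SimpleGraph

/-! ### Cutting paths by local order, and the claw. -/

namespace SimpleGraph

variable {V : Type u} {G : SimpleGraph V} {𝓑 : Set (Set V)}

/-- The local order of the set of entries of a list. -/
noncomputable def listOrder (𝓑 : Set (Set V)) (l : List V) : ℕ := localOrder 𝓑 {v | v ∈ l}

theorem listOrder_nil : listOrder 𝓑 ([] : List V) = 0 :=
  Nat.le_zero.1 (localOrder_le_length (𝓑 := 𝓑) [])

section Finite

variable [Finite V]

theorem listOrder_mono {l l' : List V} (h : l ⊆ l') : listOrder 𝓑 l ≤ listOrder 𝓑 l' :=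
  localOrder_mono h

theorem listOrder_append_le (l l' : List V) :
    listOrder 𝓑 (l ++ l') ≤ listOrder 𝓑 l + listOrder 𝓑 l' := by
  have : {v | v ∈ l ++ l'} = {v | v ∈ l} ∪ {v | v ∈ l'} := by ext; simp
  rw [listOrder, this]
  exact localOrder_union_le _ _

/-- A discrete intermediate value argument: one more vertex raises the local order by at most one.
-/
theorem exists_prefix_listOrder_eq {a : ℕ} {l : List V} (h : a ≤ listOrder 𝓑 l) :
    ∃ s t, l = s ++ t ∧ listOrder 𝓑 s = a := by
  induction l using List.reverseRecOn with
  | nil => exact ⟨[], [], rfl, by rw [listOrder_nil] at h ⊢; omega⟩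
  | append_singleton l v ih =>
    by_cases hl : a ≤ listOrder 𝓑 l
    · obtain ⟨s, t, rfl, hs⟩ := ih hl
      exact ⟨s, t ++ [v], by simp, hs⟩
    · have h₁ := listOrder_append_le (𝓑 := 𝓑) l [v]
      have h₂ : listOrder 𝓑 [v] ≤ 1 := localOrder_le_length [v]
      exact ⟨l ++ [v], [], by simp, by omega⟩

theorem exists_suffix_listOrder_eq {a : ℕ} {l : List V} (h : a ≤ listOrder 𝓑 l) :
    ∃ s t, l = s ++ t ∧ listOrder 𝓑 t = a := by
  have hrev : ∀ l : List V, listOrder 𝓑 l.reverse = listOrder 𝓑 l := fun l => by simp [listOrder]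
  obtain ⟨s, t, hst, hs⟩ := exists_prefix_listOrder_eq (a := a) (l := l.reverse) (by rwa [hrev])
  exact ⟨t.reverse, s.reverse, by rw [← List.reverse_append, ← hst, List.reverse_reverse],
    by rwa [hrev]⟩

/-- A member of the bramble that misses a list `Y` of small order. -/
theorem exists_avoids_of_listOrder_le {m : ℕ} (hm : ∀ X, IsCover 𝓑 X → m < X.card) {Y : List V}
    (hY : listOrder 𝓑 Y ≤ m) : ∃ B ∈ 𝓑, ∀ v ∈ B, v ∉ Y :=
  exists_avoids_of_localOrder_le hm hY

/-- A window `H` of order `a` slides along the middle part. The invariant is that some member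
missing `A`, `H` and `B` meets the path to the right of `H`. A member missing also the next window
`H'` lies either partly to the left of `H`, and then `H` is the wanted window, or to the right of
`H'`, and then the invariant passes to `H'`. The right-hand part cannot be exhausted. -/
theorem exists_middle_of_append {m a : ℕ} (hm : ∀ X, IsCover 𝓑 X → m < X.card) (ham : 4 * a ≤ m)
    (ha : 0 < a) {A B : List V} (hA : listOrder 𝓑 A = a) (hB : listOrder 𝓑 B = a)
    {M₁ M₂ : List V} (hcov : ∀ C ∈ 𝓑, ∃ v ∈ C, v ∈ A ++ (M₁ ++ M₂) ++ B) {l H : List V}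
    (hM₁ : M₁ = l ++ H) (hH : listOrder 𝓑 H ≤ a) (hl : l = [] ∨ listOrder 𝓑 H = a)
    (hex : ∃ C ∈ 𝓑, (∀ v ∈ C, v ∉ A ++ H ++ B) ∧ ∃ v ∈ C, v ∈ M₂) :
    ∃ l H r, M₁ ++ M₂ = l ++ H ++ r ∧ listOrder 𝓑 H = a ∧
      (∃ C ∈ 𝓑, (∀ v ∈ C, v ∉ A ++ H ++ B) ∧ ∃ v ∈ C, v ∈ l) ∧
      ∃ C ∈ 𝓑, (∀ v ∈ C, v ∉ A ++ H ++ B) ∧ ∃ v ∈ C, v ∈ r := by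
  induction M₂ generalizing M₁ l H with
  | nil => simp at hex
  | cons c M₂ ih =>
    obtain ⟨l', H', hsplit, hH', hl'⟩ : ∃ l' H', M₁ ++ [c] = l' ++ H' ∧ listOrder 𝓑 H' ≤ a ∧
        (l' = [] ∨ listOrder 𝓑 H' = a) := by
      by_cases h : a ≤ listOrder 𝓑 (M₁ ++ [c])
      · obtain ⟨s, t, hst, ht⟩ := exists_suffix_listOrder_eq h
        exact ⟨s, t, hst, ht.le, Or.inr ht⟩
      · exact ⟨[], M₁ ++ [c], rfl, by omega, Or.inl rfl⟩
    have hcH' : c ∈ H' := by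
      rcases List.eq_nil_or_concat H' with rfl | ⟨s, d, rfl⟩
      · rcases hl' with rfl | h
        · simp at hsplit
        · rw [listOrder_nil] at h; omega
      · rw [List.concat_eq_append, ← List.append_assoc] at hsplit
        have := (List.append_inj' hsplit rfl).2
        simp at this
        simp [this]
    have h₁ := listOrder_append_le (𝓑 := 𝓑) A H
    have h₂ := listOrder_append_le (𝓑 := 𝓑) (A ++ H) B
    have h₃ := listOrder_append_le (𝓑 := 𝓑) (A ++ H ++ B) H'
    -- The four lists have order at most `a` each, whence the hypothesis `4 * a ≤ m`.
    obtain ⟨C, hC, hCY⟩ := exists_avoids_of_listOrder_le hm (Y := A ++ H ++ B ++ H') (by omega)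
    obtain ⟨v, hvC, hv⟩ := hcov C hC
    have hvY := hCY v hvC
    have hvc : v ≠ c := by
      rintro rfl
      simp [hcH'] at hvY
    have hvl : v ∈ l ∨ v ∈ M₂ := by
      subst hM₁
      simp only [List.mem_append, List.mem_cons] at hv hvY
      tauto
    rcases hvl with hvl | hvM
    · subst hM₁
      refine ⟨l, H, c :: M₂, rfl, hl.resolve_left (List.ne_nil_of_mem hvl),
        ⟨C, hC, ?_, v, hvC, hvl⟩, hex⟩
      exact fun w hw hw' => hCY w hw (List.mem_append_left _ hw')
    · have := ih (M₁ := M₁ ++ [c]) (by simpa using hcov) hsplit hH' hl'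
        ⟨C, hC, fun w hw hw' => hCY w hw (by simp at hw' ⊢; tauto), v, hvC, hvM⟩
      simpa using this

/-- A bramble of large order yields three disjoint paths of large order leaving a common vertex. -/
theorem IsBramble.exists_claw (h : G.IsBramble 𝓑) {m a : ℕ}
    (hm : ∀ X, IsCover 𝓑 X → m < X.card) (ham : 4 * a ≤ m) (ha : 0 < a) :
    ∃ (x : V) (Λ : Fin 3 → List V), (∀ i, G.IsPathList (x :: Λ i)) ∧
      (∀ i j, i ≠ j → (Λ i).Disjoint (Λ j)) ∧ ∀ i, listOrder 𝓑 (Λ i) = a := by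
  obtain ⟨P, hP, hPc⟩ := h.exists_coveringPath
  have hPm : m < listOrder 𝓑 P := lt_localOrder_of_cover hm hPc.meets
  obtain ⟨A, R, rfl, hA⟩ := exists_prefix_listOrder_eq (𝓑 := 𝓑) (l := P) (a := a) (by omega)
  have hAR := listOrder_append_le (𝓑 := 𝓑) A R
  obtain ⟨M, D, rfl, hD⟩ := exists_suffix_listOrder_eq (𝓑 := 𝓑) (l := R) (a := a) (by omega)
  have hAD := listOrder_append_le (𝓑 := 𝓑) A D
  obtain ⟨C₀, hC₀, hC₀Y⟩ := exists_avoids_of_listOrder_le hm (Y := A ++ D) (by omega)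
  obtain ⟨v₀, hv₀, hv₀P⟩ := hPc.meets C₀ hC₀
  obtain ⟨l, H, r, hM, hH, ⟨B, hB, hBY, b, hbB, hbl⟩, ⟨B', hB', hB'Y, b', hbB', hbr⟩⟩ :=
    exists_middle_of_append hm ham ha hA hD (M₁ := []) (M₂ := M) (l := []) (H := [])
      (by simpa using hPc.meets) rfl (by rw [listOrder_nil]; omega) (Or.inl rfl)
      ⟨C₀, hC₀, by simpa using hC₀Y, v₀, hv₀, by
        have := hC₀Y v₀ hv₀
        simp at this hv₀P
        tauto⟩
  rw [List.nil_append] at hM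
  subst hM
  have hnd := hP.2
  have hlr : Disjoint {v | v ∈ l} {v | v ∈ r} := by
    rw [Set.disjoint_left]
    intro v hv hv'
    simp only [List.nodup_append', List.disjoint_left, List.mem_append] at hnd
    exact hnd.2.1.1.2.2 (Or.inl hv) hv'
  obtain ⟨q, hq, hqb, hqb', hqB⟩ := exists_isPathList_of_preconnected
    (h B hB B' hB').preconnected (Or.inl hbB) (Or.inr hbB')
  -- The bridge jumps over `H` from `x` in `l` to `y` in `r`, off the rest of the path. From `x`,
  -- one leg runs back through `A`, one forward through `H` to just before `y`, and one over the
  -- bridge and on through `D`; each contains a piece of order `a` and is trimmed to exactly that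
  -- order.
  obtain ⟨x, ρ, y, hρ, hx, hy, hρlr, hρq⟩ := hq.exists_bridge hlr hqb hqb' hbl hbr
  have hρP : ∀ z ∈ ρ, z ∉ A ∧ z ∉ l ∧ z ∉ H ∧ z ∉ r ∧ z ∉ D := by
    intro z hz
    have h₁ := hρlr z hz
    have h₂ : z ∉ A ++ H ++ D := by
      rcases hqB z (hρq z (by simp [hz])) with h | h
      · exact hBY z h
      · exact hB'Y z h
    simp at h₁ h₂
    tauto
  obtain ⟨u, v, rfl⟩ := List.append_of_mem (show x ∈ l from hx)
  obtain ⟨w, z, rfl⟩ := List.append_of_mem (show y ∈ r from hy)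
  have hρ' : G.IsPathList (x :: (ρ ++ y :: (z ++ D))) := by
    have hj := IsPathList.join (s := x :: ρ) (x := y) (t := z ++ D) (by simpa using hρ)
      (hP.of_isInfix ⟨A ++ (u ++ x :: v) ++ H ++ w, [], by simp⟩) ?_
    · simpa using hj
    · simp only [List.disjoint_left, List.mem_cons, List.mem_append]
      rintro t (rfl | ht) ht'
      · simp only [List.nodup_append', List.disjoint_left, List.mem_append, List.mem_cons,
          List.nodup_cons] at hnd
        grind
      · have := hρP t ht
        simp at this
        tauto
  have trim : ∀ t : List V, a ≤ listOrder 𝓑 t → G.IsPathList (x :: t) →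
      ∃ s, s ⊆ t ∧ G.IsPathList (x :: s) ∧ listOrder 𝓑 s = a := by
    intro t ht hp
    obtain ⟨s, s', rfl, hs⟩ := exists_prefix_listOrder_eq ht
    exact ⟨s, List.subset_append_left _ _, hp.of_isInfix ⟨[], s', by simp⟩, hs⟩
  obtain ⟨s₁, hs₁, hp₁, ho₁⟩ := trim (A ++ u).reverse
    (hA.symm.le.trans (listOrder_mono fun t ht => by simp [ht]))
    (by simpa using
      (hP.of_isInfix (s := A ++ u ++ [x]) ⟨[], v ++ H ++ (w ++ y :: z) ++ D, by simp⟩).reverse)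
  obtain ⟨s₂, hs₂, hp₂, ho₂⟩ := trim (v ++ H ++ w)
    (hH.symm.le.trans (listOrder_mono fun t ht => by simp [ht]))
    (hP.of_isInfix ⟨A ++ u, y :: z ++ D, by simp⟩)
  obtain ⟨s₃, hs₃, hp₃, ho₃⟩ := trim (ρ ++ y :: (z ++ D))
    (hD.symm.le.trans (listOrder_mono fun t ht => by simp [ht])) hρ'
  have d₁₂ : s₁.Disjoint s₂ := by
    intro t ht ht'
    have h₁ := hs₁ ht
    have h₂ := hs₂ ht'
    simp only [List.nodup_append', List.disjoint_left, List.mem_append, List.mem_cons,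
      List.nodup_cons, List.mem_reverse] at hnd h₁ h₂
    grind
  have d₁₃ : s₁.Disjoint s₃ := by
    intro t ht ht'
    have h₁ := hs₁ ht
    have h₂ := hs₃ ht'
    have h₃ := hρP t
    simp only [List.nodup_append', List.disjoint_left, List.mem_append, List.mem_cons,
      List.nodup_cons, List.mem_reverse] at hnd h₁ h₂ h₃
    grind
  have d₂₃ : s₂.Disjoint s₃ := by
    intro t ht ht'
    have h₁ := hs₂ ht
    have h₂ := hs₃ ht'
    have h₃ := hρP t
    simp only [List.nodup_append', List.disjoint_left, List.mem_append, List.mem_cons,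
      List.nodup_cons] at hnd h₁ h₂ h₃
    grind
  refine ⟨x, ![s₁, s₂, s₃], ?_, ?_, ?_⟩
  · intro i; fin_cases i <;> assumption
  · intro i j hij
    fin_cases i <;> fin_cases j <;> first | exact absurd rfl hij | skip
    · exact d₁₂
    · exact d₁₃
    · exact d₁₂.symm
    · exact d₂₃
    · exact d₁₃.symm
    · exact d₂₃.symm
  · intro i; fin_cases i <;> assumption

end Finite

end SimpleGraph

/-! ### Distances on cyclic lists. -/

namespace List

variable {α : Type*}

theorem IsRotated.exists_append {l l' : List α} (h : l ~r l') :
    ∃ u v, l = u ++ v ∧ l' = v ++ u := by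
  obtain ⟨n, hn, rfl⟩ := isRotated_iff_mod.1 h
  exact ⟨l.take n, l.drop n, (take_append_drop n l).symm, rotate_eq_drop_append_take hn⟩

/-- A list of distinct entries has only one rotation with a given first entry, so cyclic distances
from that entry can be read off one rotation. -/
theorem IsRotated.cons_inj {a : α} {l l' : List α} (h : (a :: l) ~r (a :: l'))
    (hnd : (a :: l).Nodup) : l = l' := by
  obtain ⟨u, v, hu, hv⟩ := h.exists_append
  cases u with
  | nil =>
    rw [nil_append] at hu
    rw [append_nil, ← hu] at hv
    exact (cons_injective hv).symm
  | cons b u =>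
    cases v with
    | nil =>
      rw [append_nil] at hu
      rw [nil_append, ← hu] at hv
      exact (cons_injective hv).symm
    | cons c v =>
      obtain rfl : a = b := by simpa using congrArg head? hu
      obtain rfl : a = c := by simpa using congrArg head? hv
      rw [hu] at hnd
      simp at hnd

/-- On the cyclic list `c`, there are at least `k` entries strictly between `e` and `f` on either
side. -/
def CyclicallyFar (k : ℕ) (c : List α) (e f : α) : Prop :=
  ∀ s t, c ~r (e :: (s ++ f :: t)) → k ≤ s.length ∧ k ≤ t.length

theorem isRotated_cons_append_cons (e f : α) (s t : List α) :
    (e :: (s ++ f :: t)) ~r (f :: (t ++ e :: s)) := by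
  simpa using isRotated_append (l := e :: s) (l' := f :: t)

theorem CyclicallyFar.symm {k : ℕ} {c : List α} {e f : α} (h : CyclicallyFar k c e f) :
    CyclicallyFar k c f e := fun s t hst =>
  (h t s (hst.trans (isRotated_cons_append_cons f e s t))).symm

theorem exists_isRotated_cons {c : List α} {e : α} (he : e ∈ c) : ∃ d, c ~r (e :: d) := by
  obtain ⟨s, t, rfl⟩ := append_of_mem he
  exact ⟨t ++ s, by simpa using isRotated_append (l := s) (l' := e :: t)⟩

/-- Once `e` is rotated to the front, the entries near it are among the first `k` and the last `k`
of the remaining ones. -/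
theorem exists_length_le_of_not_cyclicallyFar (k : ℕ) {c : List α} (hc : c.Nodup) {e : α}
    (he : e ∈ c) : ∃ L : List α, L.length ≤ 2 * k ∧ ∀ f, ¬ CyclicallyFar k c e f → f ∈ L := by
  obtain ⟨d, hd⟩ := exists_isRotated_cons he
  refine ⟨d.take k ++ d.reverse.take k, by simp; omega, fun f hf => ?_⟩
  simp only [CyclicallyFar] at hf
  push Not at hf
  obtain ⟨s, t, hst, hlen⟩ := hf
  obtain rfl := (hd.symm.trans hst).cons_inj (hd.nodup_iff.1 hc)
  have key : ∀ s t : List α, s.length < k → f ∈ (s ++ f :: t).take k := by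
    intro s t hs
    obtain ⟨j, hj⟩ := Nat.exists_eq_add_of_lt hs
    have : (f :: t).take (k - s.length) = f :: t.take j := by
      rw [show k - s.length = j + 1 by omega, take_succ_cons]
    rw [take_append, this]
    simp
  rw [mem_append]
  by_cases hs : s.length < k
  · exact Or.inl (key s t hs)
  · refine Or.inr ?_
    have := key t.reverse s.reverse (by simpa using hlen (by omega))
    simpa using this

/-- Three entries that are pairwise far from each other, in their cyclic order. -/
theorem exists_isRotated_three {k : ℕ} {c : List α} {E : Finset α} (hE : E.card = 3)
    (hEc : ∀ e ∈ E, e ∈ c) (hfar : ∀ e ∈ E, ∀ f ∈ E, e ≠ f → CyclicallyFar k c e f) :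
    ∃ e₁ ∈ E, ∃ e₂ ∈ E, ∃ e₃ ∈ E, ∃ s₁ s₂ s₃,
      c ~r (e₁ :: (s₁ ++ e₂ :: (s₂ ++ e₃ :: s₃))) ∧ e₁ ≠ e₂ ∧ e₁ ≠ e₃ ∧ e₂ ≠ e₃ ∧
        k ≤ s₁.length ∧ k ≤ s₂.length ∧ k ≤ s₃.length := by
  classical
  obtain ⟨a, b, d, hab, had, hbd, rfl⟩ := Finset.card_eq_three.1 hE
  obtain ⟨l, hl⟩ := exists_isRotated_cons (hEc a (by simp))
  have key : ∀ e f, e ∈ ({a, b, d} : Finset α) → f ∈ ({a, b, d} : Finset α) → a ≠ e → a ≠ f →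
      e ≠ f → ∀ s₁ s₂ s₃, c ~r (a :: (s₁ ++ e :: (s₂ ++ f :: s₃))) →
        k ≤ s₁.length ∧ k ≤ s₂.length ∧ k ≤ s₃.length := by
    intro e f he hf hae haf hef s₁ s₂ s₃ hr
    refine ⟨(hfar a (by simp) e he hae s₁ _ hr).1, ?_, ?_⟩
    · refine (hfar e he f hf hef s₂ (s₃ ++ a :: s₁) ?_).1
      simpa using hr.trans (isRotated_cons_append_cons a e s₁ (s₂ ++ f :: s₃))
    · refine (hfar a (by simp) f hf haf (s₁ ++ e :: s₂) s₃ ?_).2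
      simpa using hr
  have hb : b ∈ l := by
    have := hl.mem_iff.1 (hEc b (by simp))
    simpa [hab.symm] using this
  have hd : d ∈ l := by
    have := hl.mem_iff.1 (hEc d (by simp))
    simpa [had.symm] using this
  obtain ⟨s, t, rfl⟩ := append_of_mem hb
  have hd' : d ∈ s ∨ d ∈ t := by simpa [hbd.symm] using hd
  rcases hd' with h | h
  · obtain ⟨s₁, s₂, rfl⟩ := append_of_mem h
    have hl' : c ~r (a :: (s₁ ++ d :: (s₂ ++ b :: t))) := by simpa using hl
    exact ⟨a, by simp, d, by simp, b, by simp, s₁, s₂, t, hl', had, hab, hbd.symm,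
      key d b (by simp) (by simp) had hab hbd.symm _ _ _ hl'⟩
  · obtain ⟨s₂, s₃, rfl⟩ := append_of_mem h
    exact ⟨a, by simp, b, by simp, d, by simp, s, s₂, s₃, hl, hab, had, hbd,
      key b d (by simp) (by simp) hab had hbd _ _ _ hl⟩

end List

/-! ### Linkages with ends spread along a cycle. -/

namespace SimpleGraph

variable {V : Type u} {G : SimpleGraph V} {𝓑 : Set (Set V)}

/-- The graph `G` without the edges that have an end in `F`. -/
def avoiding (G : SimpleGraph V) (F : Set V) : SimpleGraph V where
  Adj u v := G.Adj u v ∧ u ∉ F ∧ v ∉ F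
  symm := ⟨fun _ _ h => ⟨h.1.symm, h.2.2, h.2.1⟩⟩
  loopless := ⟨fun _ h => G.irrefl h.1⟩

theorem IsPathList.avoiding {F : Set V} {l : List V} (h : G.IsPathList l) (hF : ∀ v ∈ l, v ∉ F) :
    (G.avoiding F).IsPathList l :=
  h.mono fun u hu v hv huv => ⟨huv, hF u hu, hF v hv⟩

theorem IsPathList.of_avoiding {F : Set V} {l : List V} (h : (G.avoiding F).IsPathList l) :
    G.IsPathList l :=
  h.mono fun _ _ _ _ huv => huv.1

/-- Vertices of `F` remain as isolated vertices, so only a one-vertex path can contain one;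
excluding the start is enough. -/
theorem IsPathList.notMem_of_avoiding {F : Set V} {l : List V} (h : (G.avoiding F).IsPathList l)
    {e : V} (he : l.head? = some e) (heF : e ∉ F) : ∀ v ∈ l, v ∉ F := by
  obtain ⟨t, rfl⟩ := List.eq_cons_of_head? he
  have hch := h.1
  clear h he
  induction t generalizing e with
  | nil => simpa using heF
  | cons f t ih =>
    rw [List.isChain_cons_cons] at hch
    intro v hv
    rcases List.mem_cons.1 hv with rfl | hv
    · exact heF
    · exact ih hch.1.2.2 hch.2 v hv

/-- A linkage into the cycle `c` that avoids `N` and whose ends are pairwise far on `c`. -/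
structure IsSpreadLinkage (G : SimpleGraph V) (k : ℕ) (N A : Set V) (c : List V) (E : Finset V)
    (p : V → List V) : Prop where
  linkage : G.IsLinkage A {v | v ∈ c} E p
  avoids : ∀ e ∈ E, ∀ z ∈ p e, z ∉ N
  far : ∀ e ∈ E, ∀ f ∈ E, e ≠ f → List.CyclicallyFar k c e f

/-- The vertices of `c` that are near to an element of `E` other than themselves. -/
def nearSet (k : ℕ) (c : List V) (E : Finset V) : Set V :=
  {f | f ∈ c ∧ ∃ e ∈ E, e ≠ f ∧ ¬ List.CyclicallyFar k c e f}

/-- The given linkage survives when `N` and the near set are forbidden: its paths meet the cycle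
only in their ends, which are far from each other. Augmentation keeps these ends and adds one
outside the near set, which is therefore far from all of them. -/
theorem IsSpreadLinkage.exists_augment {k : ℕ} {N A : Set V} {c : List V} {E : Finset V}
    {p : V → List V} (h : G.IsSpreadLinkage k N A c E p) (hN : ∀ v ∈ c, v ∉ N)
    (hsep : (G.avoiding (N ∪ nearSet k c E)).NotSeparated A ({v | v ∈ c} \ nearSet k c E) E.card) :
    ∃ E' : Finset V, E'.card = E.card + 1 ∧ ∃ q, G.IsSpreadLinkage k N A c E' q := by
  have hEJ : ∀ e ∈ E, e ∉ nearSet k c E := by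
    rintro e he ⟨-, f, hf, hfe, hnf⟩
    exact hnf (h.far f hf e he hfe)
  have hpJ : ∀ e ∈ E, ∀ z ∈ p e, z ∉ nearSet k c E := by
    intro e he z hz hzJ
    have := h.linkage.eq_of_mem e he z hz hzJ.1
    exact hEJ e he (this ▸ hzJ)
  have hlink : (G.avoiding (N ∪ nearSet k c E)).IsLinkage A ({v | v ∈ c} \ nearSet k c E) E p :=
    { isPathList := fun e he => (h.linkage.isPathList e he).avoiding fun v hv hvF =>
        hvF.elim (h.avoids e he v hv) (hpJ e he v hv)
      head := h.linkage.head
      last := h.linkage.last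
      mem := fun e he => ⟨h.linkage.mem e he, hEJ e he⟩
      eq_of_mem := fun e he z hz hzB => h.linkage.eq_of_mem e he z hz hzB.1
      disjoint := h.linkage.disjoint }
  obtain ⟨E', hEE', hcard, q, hq⟩ := hlink.exists_augment hsep
  have hqF : ∀ e ∈ E', ∀ z ∈ q e, z ∉ N ∪ nearSet k c E := fun e he =>
    (hq.isPathList e he).notMem_of_avoiding (hq.head e he) fun heF =>
      heF.elim (hN e (hq.mem e he).1) (hq.mem e he).2
  have hone : ∀ e ∈ E', ∀ f ∈ E', e ∉ E → f ∉ E → e = f := by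
    classical
    intro e he f hf heE hfE
    have h₁ : (E' \ E).card = 1 := by rw [Finset.card_sdiff_of_subset hEE']; omega
    exact Finset.card_le_one.1 h₁.le e (by simp [he, heE]) f (by simp [hf, hfE])
  have hnew : ∀ e ∈ E, ∀ f ∈ E', e ≠ f → List.CyclicallyFar k c e f := by
    intro e he f hf hef
    by_contra hn
    exact (hq.mem f hf).2 ⟨(hq.mem f hf).1, e, he, hef, hn⟩
  refine ⟨E', hcard, q, ⟨?_, fun e he z hz hzN => hqF e he z hz (Or.inl hzN), ?_⟩⟩
  · exact
    { isPathList := fun e he => (hq.isPathList e he).of_avoiding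
      head := hq.head
      last := hq.last
      mem := fun e he => (hq.mem e he).1
      eq_of_mem := fun e he z hz hzB =>
        hq.eq_of_mem e he z hz ⟨hzB, fun hzJ => hqF e he z hz (Or.inr hzJ)⟩
      disjoint := hq.disjoint }
  · intro e he f hf hef
    by_cases heE : e ∈ E
    · exact hnew e heE f hf hef
    by_cases hfE : f ∈ E
    · exact (hnew f hfE e he hef.symm).symm
    · exact absurd (hone e he f hf heE hfE) hef

theorem localOrder_nearSet_le [Finite V] (k : ℕ) {c : List V} (hc : c.Nodup) {E : Finset V}
    (hE : ∀ e ∈ E, e ∈ c) : localOrder 𝓑 (nearSet k c E) ≤ 2 * k * E.card := by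
  classical
  choose! L hL hLmem using fun e he =>
    List.exists_length_le_of_not_cyclicallyFar k hc (e := e) (hE e he)
  have hsub : nearSet k c E ⊆ ((E.biUnion fun e => (L e).toFinset : Finset V) : Set V) := by
    rintro f ⟨-, e, he, -, hnf⟩
    simp only [Finset.coe_biUnion, Set.mem_iUnion, Finset.mem_coe, List.mem_toFinset]
    exact ⟨e, he, hLmem e he f hnf⟩
  refine (localOrder_mono hsub).trans ((localOrder_le_card _).trans ?_)
  rw [mul_comm]
  exact Finset.card_biUnion_le_card_mul _ _ _ fun e he => (L e).toFinset_card_le.trans (hL e he)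

/-- Two vertices do not separate the three legs of a claw from a cycle covering the bramble. -/
theorem IsBramble.notSeparated_of_claw [Finite V] (h : G.IsBramble 𝓑) {m : ℕ}
    (hm : ∀ X, IsCover 𝓑 X → m < X.card) {S N J : Set V} {near far : Fin 3 → List V}
    {n : Fin 3 → V} {c : List V}
    (hpath : ∀ i, G.IsPathList (near i ++ n i :: far i))
    (hdisj : ∀ i j, i ≠ j → (near i ++ n i :: far i).Disjoint (near j ++ n j :: far j))
    (hnear : ∀ i, ∀ v ∈ near i, v ∈ N) (hfar : ∀ i, ∀ v ∈ n i :: far i, v ∈ S ∧ v ∉ N)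
    (hNS : N ⊆ S) (hcS : ∀ v ∈ c, v ∉ S) (hJc : ∀ v ∈ J, v ∈ c)
    (hcov : ∀ B ∈ 𝓑, (∀ v ∈ B, v ∉ S) → ∃ v ∈ B, v ∈ c)
    (hord : ∀ i, localOrder 𝓑 N + localOrder 𝓑 J + 2 < listOrder 𝓑 (near i ++ n i :: far i))
    (hS : localOrder 𝓑 S + localOrder 𝓑 J + 2 ≤ m) {r : ℕ} (hr : r ≤ 2) :
    (G.avoiding (N ∪ J)).NotSeparated (Set.range n) ({v | v ∈ c} \ J) r := by
  classical
  intro Z hZ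
  -- The three legs are disjoint and `Z` has at most two vertices, so one leg is untouched.
  obtain ⟨i, hi⟩ : ∃ i, ∀ z ∈ Z, z ∉ near i ++ n i :: far i := by
    by_contra! hno
    choose g hgZ hg using hno
    have hinj : Function.Injective g := by
      intro i j hij
      by_contra hne
      exact hdisj i j hne (hg i) (hij ▸ hg j)
    have := Finset.card_le_card_of_injOn (s := Finset.univ) (t := Z) g (fun i _ => hgZ i)
      (hinj.injOn)
    simp at this
    omega
  have hZo : localOrder 𝓑 (Z : Set V) ≤ 2 := (localOrder_le_card Z).trans (hZ.trans hr)
  have h₁ := localOrder_union_le (𝓑 := 𝓑) (N ∪ J) Z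
  have h₂ := localOrder_union_le (𝓑 := 𝓑) N J
  have h₃ := localOrder_union_le (𝓑 := 𝓑) (S ∪ J) Z
  have h₄ := localOrder_union_le (𝓑 := 𝓑) S J
  -- `B₁` leaves the untouched leg, necessarily from its far part, and `B₂` reaches the cycle. Both
  -- miss everything forbidden, and together with the far part they connect `n i` to the cycle.
  obtain ⟨B₁, hB₁, ⟨v, hvB, hv⟩, hB₁Y⟩ := exists_meets_of_localOrder_lt (𝓑 := 𝓑)
    (Y := N ∪ J ∪ Z) (S := {v | v ∈ near i ++ n i :: far i})
    (lt_of_le_of_lt (by omega) (hord i))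
  obtain ⟨B₂, hB₂, hB₂Y⟩ := exists_avoids_of_localOrder_le hm (Y := S ∪ J ∪ Z) (by omega)
  obtain ⟨b, hbB, hbc⟩ := hcov B₂ hB₂ fun v hv hvS => hB₂Y v hv (Or.inl (Or.inl hvS))
  have hvf : v ∈ n i :: far i := by
    rcases List.mem_append.1 hv with hv | hv
    · exact absurd (Or.inl (Or.inl (hnear i v hv))) (hB₁Y v hvB)
    · exact hv
  have hconn := induce_union_connected (h B₁ hB₁ B₂ hB₂).preconnected
    ((hpath i).append_right.connected_induce (by simp)).preconnected ⟨v, Or.inl hvB, hvf⟩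
  obtain ⟨l, hl, hb, hn, hlS⟩ := exists_isPathList_of_preconnected hconn.preconnected
    (u := b) (v := n i) (Or.inl (Or.inr hbB)) (Or.inr (by simp))
  have hlF : ∀ w ∈ l, w ∉ N ∪ J ∧ w ∉ Z := by
    intro w hw
    rcases hlS w hw with (hw | hw) | hw
    · exact ⟨fun hF => hB₁Y w hw (Or.inl hF), fun hF => hB₁Y w hw (Or.inr hF)⟩
    · exact ⟨fun hF => hB₂Y w hw (Or.inl (hF.imp (@hNS w) id)), fun hF => hB₂Y w hw (Or.inr hF)⟩
    · refine ⟨fun hF => hF.elim (hfar i w hw).2 fun hJ => hcS w (hJc w hJ) (hfar i w hw).1,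
        fun hF => hi w hF (List.mem_append_right _ hw)⟩
  exact ⟨l, hl.avoiding fun w hw => (hlF w hw).1,
    ⟨b, ⟨hbc, fun hJ => hB₂Y b hbB (Or.inl (Or.inr hJ))⟩, hb⟩,
    ⟨n i, ⟨i, rfl⟩, hn⟩, fun w hw => (hlF w hw).2⟩

end SimpleGraph

/-! ### Subdivided tetrahedra from vertex lists. -/

namespace SimpleGraph

variable {V : Type u} {G : SimpleGraph V} {𝓑 : Set (Set V)}

theorem IsPathList.exists_walk {a b : V} {l : List V} (h : G.IsPathList (a :: (l ++ [b]))) :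
    ∃ w : G.Walk a b, w.support = a :: (l ++ [b]) := by
  obtain ⟨hc, -⟩ := h
  induction l generalizing a with
  | nil => exact ⟨Walk.cons (by simpa using hc) Walk.nil, rfl⟩
  | cons c l ih =>
    rw [List.cons_append, List.isChain_cons_cons] at hc
    obtain ⟨w, hw⟩ := ih hc.2
    exact ⟨Walk.cons hc.1 w, by rw [Walk.support_cons, hw, List.cons_append]⟩

theorem Walk.exists_walk_coe {a b : V} (w : G.Walk a b) {F : G.Subgraph}
    (hF : w.toSubgraph ≤ F) (ha : a ∈ F.verts) (hb : b ∈ F.verts) :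
    ∃ w' : F.coe.Walk ⟨a, ha⟩ ⟨b, hb⟩, w'.support.map Subtype.val = w.support ∧
      w'.edges.map (Sym2.map Subtype.val) = w.edges := by
  induction w with
  | nil => exact ⟨Walk.nil, rfl, rfl⟩
  | @cons a c b h w ih =>
    have hFw : w.toSubgraph ≤ F := le_trans le_sup_right hF
    have hadj : F.Adj a c := hF.2 (by simp [Walk.toSubgraph])
    obtain ⟨w', h₁, h₂⟩ := ih hFw hadj.snd_mem hb
    have hadj' : F.coe.Adj ⟨a, ha⟩ ⟨c, hadj.snd_mem⟩ := hadj
    exact ⟨Walk.cons hadj' w', by simp [h₁], by simp [h₂]⟩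

/-- A subdivision of the tetrahedron from its branch vertices and the inner vertices of its six
paths. -/
theorem exists_isSubdividedTetrahedron {k : ℕ} {b : Fin 4 → V} (hb : Function.Injective b)
    {inner : Fin 4 → Fin 4 → List V}
    (hpath : ∀ i j, i < j → G.IsPathList (b i :: (inner i j ++ [b j])))
    (hlen : ∀ i j, i < j → k ≤ (inner i j).length)
    (hbranch : ∀ i j, i < j → ∀ t, b t ∉ inner i j)
    (hdisj : ∀ i j, i < j → ∀ i' j', i' < j' → (i, j) ≠ (i', j') →
      (inner i j).Disjoint (inner i' j')) :
    ∃ F : G.Subgraph, IsSubdividedTetrahedron k F.coe := by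
  choose w hw using fun i j (h : i < j) => (hpath i j h).exists_walk
  let F : G.Subgraph := ⨆ i, ⨆ j, ⨆ h, (w i j h).toSubgraph
  have hle : ∀ i j h, (w i j h).toSubgraph ≤ F := fun i j h =>
    le_iSup_of_le i (le_iSup_of_le j (le_iSup_of_le h le_rfl))
  have hverts : ∀ v, v ∈ F.verts ↔ ∃ i j, ∃ h : i < j, v ∈ (w i j h).support := by
    intro v
    simp [F]
  have hadj : ∀ u v, F.Adj u v ↔ ∃ i j, ∃ h : i < j, s(u, v) ∈ (w i j h).edges := by
    intro u v
    simp [F, Walk.adj_toSubgraph_iff_mem_edges]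
  have hbF : ∀ i, b i ∈ F.verts := by
    intro i
    rw [hverts]
    by_cases hi : i = 3
    · exact ⟨0, 3, by decide, by rw [hi]; exact (w 0 3 _).end_mem_support⟩
    · exact ⟨i, 3, by omega, (w i 3 _).start_mem_support⟩
  choose p hp hpe using fun i j h => (w i j h).exists_walk_coe (hle i j h) (hbF i) (hbF j)
  have hsupp : ∀ i j h (v : F.verts), v ∈ (p i j h).support ↔ v.1 ∈ (w i j h).support := by
    intro i j h v
    rw [← hp i j h, List.mem_map_of_injective Subtype.val_injective]
  have hend : ∀ i j h i' j' h', (i, j) ≠ (i', j') → ∀ v, v ∈ (w i j h).support →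
      v ∈ (w i' j' h').support → v = b i ∨ v = b j := by
    intro i j h i' j' h' hne v hv hv'
    rw [hw] at hv hv'
    simp only [List.mem_cons, List.mem_append, List.not_mem_nil, or_false] at hv hv'
    rcases hv with hv | hv | hv
    · exact Or.inl hv
    · rcases hv' with rfl | hv' | rfl
      · exact absurd hv (hbranch i j h _)
      · exact absurd hv' (hdisj i j h i' j' h' hne hv)
      · exact absurd hv (hbranch i j h _)
    · exact Or.inr hv
  refine ⟨F, ⟨{
    branch := fun i => ⟨b i, hbF i⟩
    branch_injective := fun i j hij => hb (congrArg Subtype.val hij)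
    path := p
    isPath := ?_
    le_length := ?_
    inter_ends := ?_
    vertex_mem := ?_
    edge_mem := ?_ }⟩⟩
  · intro i j h
    rw [Walk.isPath_def, ← List.nodup_map_iff Subtype.val_injective, hp, hw]
    exact (hpath i j h).2
  · intro i j h
    have h₁ := congrArg List.length ((hp i j h).trans (hw i j h))
    simp at h₁
    have := hlen i j h
    omega
  · intro i j h i' j' h' hne v hv hv'
    rw [hsupp] at hv hv'
    simp only [Subtype.ext_iff]
    exact ⟨hend i j h i' j' h' hne v hv hv', hend i' j' h' i j h hne.symm v hv' hv⟩
  · intro v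
    obtain ⟨i, j, h, hv⟩ := (hverts v).1 v.2
    exact ⟨i, j, h, (hsupp i j h v).2 hv⟩
  · intro e he
    induction e with
    | _ u v =>
    obtain ⟨i, j, h, huv⟩ := (hadj u v).1 he
    refine ⟨i, j, h, ?_⟩
    rw [← hpe i j h] at huv
    exact (List.mem_map_of_injective (Sym2.map.injective Subtype.val_injective)).1 huv

end SimpleGraph

namespace SimpleGraph

variable {V : Type u} {G : SimpleGraph V} {𝓑 : Set (Set V)}

/-- A cycle together with three disjoint paths from a common vertex to it. -/
theorem exists_isSubdividedTetrahedron_of_cycle {k : ℕ} {x e₁ e₂ e₃ : V}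
    {s₁ s₂ s₃ l₁ l₂ l₃ : List V} (hc : G.IsCycleList (e₁ :: (s₁ ++ e₂ :: (s₂ ++ e₃ :: s₃))))
    (hs₁ : k ≤ s₁.length) (hs₂ : k ≤ s₂.length) (hs₃ : k ≤ s₃.length)
    (hl₁ : k ≤ l₁.length) (hl₂ : k ≤ l₂.length) (hl₃ : k ≤ l₃.length)
    (hp₁ : G.IsPathList (x :: (l₁ ++ [e₁]))) (hp₂ : G.IsPathList (x :: (l₂ ++ [e₂])))
    (hp₃ : G.IsPathList (x :: (l₃ ++ [e₃])))
    (hx : x ∉ e₁ :: (s₁ ++ e₂ :: (s₂ ++ e₃ :: s₃)))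
    (hd₁ : l₁.Disjoint (e₁ :: (s₁ ++ e₂ :: (s₂ ++ e₃ :: s₃))))
    (hd₂ : l₂.Disjoint (e₁ :: (s₁ ++ e₂ :: (s₂ ++ e₃ :: s₃))))
    (hd₃ : l₃.Disjoint (e₁ :: (s₁ ++ e₂ :: (s₂ ++ e₃ :: s₃))))
    (hd₁₂ : l₁.Disjoint l₂) (hd₁₃ : l₁.Disjoint l₃) (hd₂₃ : l₂.Disjoint l₃) :
    ∃ F : G.Subgraph, IsSubdividedTetrahedron k F.coe := by
  obtain ⟨hnd, hch⟩ := hc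
  have hch' : (e₁ :: (s₁ ++ e₂ :: (s₂ ++ e₃ :: s₃)) ++ [e₁]).IsChain G.Adj := by
    simpa using hch
  have hx₁ : x ∉ l₁ ∧ x ∉ l₂ ∧ x ∉ l₃ := by
    have h₁ := hp₁.2
    have h₂ := hp₂.2
    have h₃ := hp₃.2
    simp only [List.nodup_cons, List.mem_append] at h₁ h₂ h₃
    tauto
  have hq₁ : G.IsPathList (e₁ :: (s₁ ++ [e₂])) :=
    ⟨hch'.of_isInfix ⟨[], s₂ ++ e₃ :: s₃ ++ [e₁], by simp⟩,
      hnd.sublist (List.IsInfix.sublist ⟨[], s₂ ++ e₃ :: s₃, by simp⟩)⟩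
  have hq₂ : G.IsPathList (e₂ :: (s₂ ++ [e₃])) :=
    ⟨hch'.of_isInfix ⟨e₁ :: s₁, s₃ ++ [e₁], by simp⟩,
      hnd.sublist (List.IsInfix.sublist ⟨e₁ :: s₁, s₃, by simp⟩)⟩
  simp only [List.nodup_append', List.disjoint_left, List.mem_append, List.mem_cons,
    List.nodup_cons, not_or] at hnd hx hd₁ hd₂ hd₃ hd₁₂ hd₁₃ hd₂₃
  have hq₃ : G.IsPathList (e₁ :: (s₃.reverse ++ [e₃])) := by
    have : G.IsPathList (e₃ :: s₃ ++ [e₁]) := by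
      refine ⟨hch'.of_isInfix ⟨e₁ :: (s₁ ++ e₂ :: s₂), [], by simp⟩, ?_⟩
      simp only [List.cons_append, List.nodup_append', List.disjoint_left, List.mem_append,
        List.mem_cons, List.nodup_cons]
      grind
    simpa using this.reverse
  -- Numbers the edges 01, 02, 03, 12, 13, 23; entries with `i ≥ j` are dummies. In `D` below, `s₃`
  -- is reversed because the cycle traverses it from `e₃` to `e₁`.
  let idx : Fin 4 → Fin 4 → Fin 6 := ![![0, 0, 1, 2], ![0, 0, 3, 4], ![0, 0, 0, 5], ![0, 0, 0, 0]]
  have hidx : ∀ i j, i < j → ∀ i' j', i' < j' → (i, j) ≠ (i', j') → idx i j ≠ idx i' j' := by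
    decide
  let D : Fin 6 → List V := ![l₁, l₂, l₃, s₁, s₃.reverse, s₂]
  have hD : ∀ u v, u < v → (D u).Disjoint (D v) := by
    intro u v huv
    fin_cases u <;> fin_cases v <;>
      first
      | exact absurd huv (by decide)
      | (simp only [D, List.disjoint_left]
         simp
         grind)
  refine exists_isSubdividedTetrahedron (b := ![x, e₁, e₂, e₃]) (inner := fun i j => D (idx i j))
    ?_ ?_ ?_ ?_ ?_
  · intro i j hij
    fin_cases i <;> fin_cases j <;> simp at hij ⊢ <;> grind
  · intro i j hij
    fin_cases i <;> fin_cases j <;>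
      first
      | exact absurd hij (by decide)
      | assumption
  · intro i j _
    generalize idx i j = u
    fin_cases u <;> simp [D] <;> assumption
  · intro i j _ t
    generalize idx i j = u
    fin_cases u <;> fin_cases t <;> simp [D] <;> grind
  · intro i j hij i' j' hij' hne
    rcases lt_or_gt_of_ne (hidx i j hij i' j' hij' hne) with h | h
    · exact hD _ _ h
    · exact (hD _ _ h).symm

end SimpleGraph

/-! ### Joining the claw to the cycle. -/

namespace SimpleGraph

variable {V : Type u} {G : SimpleGraph V} {𝓑 : Set (Set V)}

/-- The vertices of a claw with centre `x` and the given legs. -/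
def clawSet (x : V) (leg : Fin 3 → List V) : Set V := {v | v = x ∨ ∃ i, v ∈ leg i}

theorem localOrder_clawSet_le [Finite V] (x : V) (leg : Fin 3 → List V) :
    localOrder 𝓑 (clawSet x leg) ≤
      1 + (listOrder 𝓑 (leg 0) + (listOrder 𝓑 (leg 1) + listOrder 𝓑 (leg 2))) := by
  have hset : clawSet x leg = {v | v ∈ [x] ++ (leg 0 ++ (leg 1 ++ leg 2))} := by
    ext v
    simp [clawSet, Fin.exists_fin_succ]
  have h₀ : listOrder 𝓑 [x] ≤ 1 := localOrder_le_length [x]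
  have h₁ := listOrder_append_le (𝓑 := 𝓑) [x] (leg 0 ++ (leg 1 ++ leg 2))
  have h₂ := listOrder_append_le (𝓑 := 𝓑) (leg 0) (leg 1 ++ leg 2)
  have h₃ := listOrder_append_le (𝓑 := 𝓑) (leg 1) (leg 2)
  rw [hset]
  exact h₁.trans (by omega)

/-- A linkage from the legs of a claw to a cycle completes the claw and the cycle to a
subdivided tetrahedron. -/
theorem IsSpreadLinkage.exists_isSubdividedTetrahedron {k : ℕ} {x : V}
    {near : Fin 3 → List V} {n : Fin 3 → V} {c : List V} {E : Finset V} {p : V → List V}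
    (hc : G.IsCycleList c) (hE : E.card = 3)
    (h : G.IsSpreadLinkage k (clawSet x near) (Set.range n) c E p)
    (hpath : ∀ i, G.IsPathList (x :: (near i ++ [n i])))
    (hdisj : ∀ i j, i ≠ j → (near i).Disjoint (near j)) (hlen : ∀ i, k ≤ (near i).length + 1)
    (hcS : ∀ v ∈ c, v ∉ clawSet x near) (hcn : ∀ i, n i ∉ c) :
    ∃ F : G.Subgraph, IsSubdividedTetrahedron k F.coe := by
  have hlast : ∀ e ∈ E, ∃ i, (p e).getLast? = some (n i) := by
    intro e he
    obtain ⟨_, ⟨i, rfl⟩, hi⟩ := h.linkage.last e he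
    exact ⟨i, hi⟩
  choose! σ hσ using hlast
  have hσ_inj : ∀ e ∈ E, ∀ f ∈ E, e ≠ f → σ e ≠ σ f := by
    intro e he f hf hef heq
    refine h.linkage.disjoint e he f hf hef (List.mem_of_getLast?_eq (hσ e he)) ?_
    rw [heq]
    exact List.mem_of_getLast?_eq (hσ f hf)
  have hcons : ∀ e ∈ E, p e = e :: (p e).tail := by
    intro e he
    obtain ⟨t, ht⟩ := List.eq_cons_of_head? (h.linkage.head e he)
    rw [ht, List.tail_cons]
  -- The inner vertices from `x` to `e`: the kept start of a leg, then the linkage path traversed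
  -- backwards from `n (σ e)`, without `e`.
  let leg : V → List V := fun e => near (σ e) ++ (p e).tail.reverse
  have hmem : ∀ e ∈ E, ∀ z ∈ leg e, z ∈ near (σ e) ∨ z ∈ p e ∧ z ≠ e := by
    intro e he z hz
    rcases List.mem_append.1 hz with hz | hz
    · exact Or.inl hz
    · rw [List.mem_reverse] at hz
      refine Or.inr ⟨List.mem_of_mem_tail hz, ?_⟩
      rintro rfl
      have := (h.linkage.isPathList z he).2
      rw [hcons z he] at this
      exact (List.nodup_cons.1 this).1 hz
  have hleg : ∀ e ∈ E, G.IsPathList (x :: (leg e ++ [e])) := by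
    intro e he
    have hrev := (h.linkage.isPathList e he).reverse
    obtain ⟨t, ht⟩ := List.eq_cons_of_head? (l := (p e).reverse) (a := n (σ e))
      (by rw [List.head?_reverse]; exact hσ e he)
    have hd : (x :: near (σ e)).Disjoint (p e).reverse := by
      intro z hz hz'
      refine h.avoids e he z (List.mem_reverse.1 hz') ?_
      rcases List.mem_cons.1 hz with rfl | hz
      · exact Or.inl rfl
      · exact Or.inr ⟨_, hz⟩
    have hj := IsPathList.join (s := x :: near (σ e)) (hpath (σ e)) (ht ▸ hrev) (ht ▸ hd)
    rw [← ht, hcons e he, List.reverse_cons] at hj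
    simpa [leg] using hj
  have hleg_len : ∀ e ∈ E, k ≤ (leg e).length := by
    intro e he
    -- Since `n (σ e)` is off the cycle, it is itself an inner vertex, making up for the one missing
    -- from the `k - 1` kept vertices.
    have hne : (p e).tail ≠ [] := by
      intro hnil
      have h₁ := hσ e he
      rw [hcons e he, hnil, List.getLast?_singleton] at h₁
      exact hcn (σ e) (Option.some_inj.1 h₁ ▸ h.linkage.mem e he)
    have h₁ := List.length_pos_of_ne_nil hne
    have h₂ := hlen (σ e)
    simp only [leg, List.length_append, List.length_reverse]
    omega
  have hleg_c : ∀ e ∈ E, (leg e).Disjoint c := by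
    intro e he z hz hzc
    rcases hmem e he z hz with hz | ⟨hz, hne⟩
    · exact hcS z hzc (Or.inr ⟨_, hz⟩)
    · exact hne (h.linkage.eq_of_mem e he z hz hzc)
  have hleg_disj : ∀ e ∈ E, ∀ f ∈ E, e ≠ f → (leg e).Disjoint (leg f) := by
    intro e he f hf hef z hz hz'
    rcases hmem e he z hz with h₁ | ⟨h₁, -⟩ <;> rcases hmem f hf z hz' with h₂ | ⟨h₂, -⟩
    · exact hdisj _ _ (hσ_inj e he f hf hef) h₁ h₂
    · exact h.avoids f hf z h₂ (Or.inr ⟨_, h₁⟩)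
    · exact h.avoids e he z h₁ (Or.inr ⟨_, h₂⟩)
    · exact h.linkage.disjoint e he f hf hef h₁ h₂
  obtain ⟨e₁, he₁, e₂, he₂, e₃, he₃, s₁, s₂, s₃, hr, h₁₂, h₁₃, h₂₃, hs₁, hs₂, hs₃⟩ :=
    List.exists_isRotated_three hE h.linkage.mem h.far
  have hd : ∀ e ∈ E, (leg e).Disjoint (e₁ :: (s₁ ++ e₂ :: (s₂ ++ e₃ :: s₃))) :=
    fun e he z hz hz' => hleg_c e he hz (hr.mem_iff.2 hz')
  refine exists_isSubdividedTetrahedron_of_cycle (x := x) ⟨hr.nodup_iff.1 hc.1, ?_⟩ hs₁ hs₂ hs₃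
    (hleg_len e₁ he₁) (hleg_len e₂ he₂) (hleg_len e₃ he₃) (hleg e₁ he₁) (hleg e₂ he₂) (hleg e₃ he₃)
    (fun hx => hcS x (hr.mem_iff.2 hx) (Or.inl rfl)) (hd e₁ he₁) (hd e₂ he₂) (hd e₃ he₃)
    (hleg_disj e₁ he₁ e₂ he₂ h₁₂) (hleg_disj e₁ he₁ e₃ he₃ h₁₃) (hleg_disj e₂ he₂ e₃ he₃ h₂₃)
  rw [← Cycle.coe_eq_coe.2 hr]
  exact hc.2

/-- A bramble of large order forces a subdivided tetrahedron. -/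
theorem IsBramble.exists_isSubdividedTetrahedron [Finite V] (h : G.IsBramble 𝓑) {k : ℕ}
    (hk : 1 ≤ k) (hm : ∀ X, IsCover 𝓑 X → 32 * k + 2 < X.card) :
    ∃ F : G.Subgraph, IsSubdividedTetrahedron k F.coe := by
  -- The order `7 * k + 1` exceeds by one the sum of `3 * k - 2` for the kept part, `4 * k` for the
  -- near set of two ends and 2 for a separator.
  obtain ⟨x, Λ, hΛ, hΛd, hΛo⟩ := h.exists_claw (a := 7 * k + 1) hm (by omega) (by omega)
  have hsplit : ∀ i, ∃ near n far, Λ i = near ++ n :: far ∧ near.length = k - 1 := by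
    intro i
    have hl : 7 * k + 1 ≤ (Λ i).length := (hΛo i).symm.le.trans (localOrder_le_length (Λ i))
    cases hd : (Λ i).drop (k - 1) with
    | nil => rw [List.drop_eq_nil_iff] at hd; omega
    | cons n far =>
      refine ⟨(Λ i).take (k - 1), n, far, ?_, by simp; omega⟩
      rw [← hd, List.take_append_drop]
  choose near n far hsp hnl using hsplit
  have hnear : ∀ i, near i ⊆ Λ i := fun i v hv => by rw [hsp i]; simp [hv]
  have hfar : ∀ i, n i :: far i ⊆ Λ i := fun i v hv => by
    rw [hsp i]; exact List.mem_append_right _ hv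
  have hNS : clawSet x near ⊆ clawSet x Λ := fun v hv => hv.imp id fun ⟨i, hi⟩ => ⟨i, hnear i hi⟩
  have hNo : localOrder 𝓑 (clawSet x near) ≤ 3 * k - 2 := by
    have hle : ∀ i, listOrder 𝓑 (near i) ≤ k - 1 := fun i =>
      (localOrder_le_length (near i)).trans (hnl i).le
    have := localOrder_clawSet_le (𝓑 := 𝓑) x near
    have h₀ := hle 0
    have h₁ := hle 1
    have h₂ := hle 2
    omega
  have hSo : localOrder 𝓑 (clawSet x Λ) ≤ 21 * k + 4 := by
    have := localOrder_clawSet_le (𝓑 := 𝓑) x Λ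
    have h₀ := hΛo 0
    have h₁ := hΛo 1
    have h₂ := hΛo 2
    omega
  have hfarN : ∀ i, ∀ v ∈ n i :: far i, v ∈ clawSet x Λ ∧ v ∉ clawSet x near := by
    intro i v hv
    refine ⟨Or.inr ⟨i, hfar i hv⟩, ?_⟩
    rintro (rfl | ⟨j, hj⟩)
    · exact (List.nodup_cons.1 (hΛ i).2).1 (hfar i hv)
    · by_cases hij : i = j
      · subst hij
        have hnd := (List.nodup_cons.1 (hΛ i).2).2
        rw [hsp i, List.nodup_append'] at hnd
        exact hnd.2.2 hj hv
      · exact hΛd i j hij (hfar i hv) (hnear j hj)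
  obtain ⟨c, hc, hcS, hccov⟩ := h.exists_cycle_disjoint hm (S := clawSet x Λ) (by omega)
  have hlink : ∀ r ≤ 3, ∃ E : Finset V, E.card = r ∧
      ∃ p, G.IsSpreadLinkage k (clawSet x near) (Set.range n) c E p := by
    intro r
    induction r with
    | zero =>
      exact fun _ => ⟨∅, rfl, fun _ => [], ⟨by constructor <;> simp, by simp, by simp⟩⟩
    | succ r ih =>
      intro hr
      obtain ⟨E, hE, p, hp⟩ := ih (by omega)
      have hJ := localOrder_nearSet_le (𝓑 := 𝓑) k hc.1 hp.linkage.mem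
      have hJ' : localOrder 𝓑 (nearSet k c E) ≤ 4 * k := by
        refine hJ.trans ?_
        rw [hE]
        nlinarith
      obtain ⟨E', hE', q, hq⟩ := hp.exists_augment (fun v hv hvN => hcS v hv (hNS hvN))
        (h.notSeparated_of_claw hm (S := clawSet x Λ) (N := clawSet x near)
          (near := near) (far := far)
          (fun i => hsp i ▸ (hΛ i).of_isInfix ⟨[x], [], by simp⟩)
          (fun i j hij => hsp i ▸ hsp j ▸ hΛd i j hij)
          (fun i v hv => Or.inr ⟨i, hv⟩) hfarN hNS hcS (fun v hv => hv.1) hccov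
          -- The first bound is `(3 * k - 2) + 4 * k + 2 < 7 * k + 1`; the second is `(21 * k + 4) +
          -- 4 * k + 2 ≤ 32 * k + 2`, which uses `k ≥ 1`.
          (fun i => by rw [← hsp i, hΛo i]; omega) (by omega) (by omega))
      exact ⟨E', by omega, q, hq⟩
  obtain ⟨E, hE, p, hp⟩ := hlink 3 le_rfl
  refine hp.exists_isSubdividedTetrahedron hc hE ?_ ?_ ?_ ?_ ?_
  · intro i
    have := hΛ i
    rw [hsp i] at this
    exact this.of_isInfix ⟨[], far i, by simp⟩
  · intro i j hij v hv hv'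
    exact hΛd i j hij (hnear i hv) (hnear j hv')
  · intro i
    have := hnl i
    omega
  · exact fun v hv hvN => hcS v hv (hNS hvN)
  · exact fun i hi => hcS (n i) hi (hfarN i (n i) (by simp)).1

end SimpleGraph

theorem mainTheorem2 {V : Type u} [Finite V] (G : SimpleGraph V) (k : ℕ) (hk : 1 ≤ k)
    (htw : 32 * (k : ℤ) + 2 ≤ treewidth G) :
    ∃ F : G.Subgraph, IsSubdividedTetrahedron k F.coe := by
  obtain ⟨𝓑, h𝓑, hm⟩ := SimpleGraph.exists_isBramble_of_le_treewidth (G := G) (m := 32 * k + 2)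
    (by push_cast; exact htw)
  exact h𝓑.exists_isSubdividedTetrahedron hk hm
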